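/- Let $n\ge 3$ and let $D=\{x_1,\dots,x_n\}\subset\mathbb{CP}^1$ be $n$ distinct ordered points. A rank-2 quasi-parabolic $SL(2,\mathbb C)$-Higgs bundle over $\mathbb{CP}^1$ at $D$ is a pair $(E,\Phi)$, where $E$ is a rank-2 holomorphic vector bundle with trivial determinant together with complete flags $E_x=E_{x,1}\supset E_{x,2}\supset\{0\}$, $\dim E_{x,2}=1$, at all $x\in D$, and $\Phi$ is a traceless holomorphic section of $\mathrm{End}(E)\otimes K_{\mathbb{CP}^1}(D)$ with $(\mathrm{Res}_x\Phi)(E_x)\subset E_{x,2}$ and $(\mathrm{Res}_x\Phi)(E_{x,2})=0$ for all $x\in D$. It is stable if all residues $\mathrm{Res}_x\Phi$, $x\in D$, are nonzero and every holomorphic line subbundle $L\subset E$ with $\Phi(L)\subset L\otimes K_{\mathbb{CP}^1}(D)$ satisfies $$\deg(L)+\tfrac12\,\bigl|\{x\in D: L_x=E_{x,2}\}\bigr|<\tfrac12\bigl(\deg(E)+n\bigr).$$ Let $\mathcal H_0^n$ be the moduli space of isomorphism classes of stable rank-2 quasi-parabolic $SL(2,\mathbb C)$-Higgs bundles over $\mathbb{CP}^1$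 at $D$ whose underlying holomorphic vector bundle is trivial. After choosing a trivialization $E=\mathbb{CP}^1\times\mathbb C^2$, such a bundle is determined by its flags and its residues, and $\mathcal H_0^n$ carries the resulting quotient topology and quotient smooth structure. Let $\Theta:\mathcal H_0^n\to\mathcal H_0^n$ be the involution $(E,\Phi)\mapsto(E^*,\Phi^t)$, where $E^*$ has the dual flags (the annihilators of the lines $E_{x,2}$). For $S\subset\{1,\dots,n\}$ let $\mathcal Z_S\subset\mathcal H_0^n$ be the set of classes of those $(E,\Phi)$ for which (i) $E=L_0\oplus L_1$ with $L_0,L_1$ trivial holomorphic line bundles, $E_{x_i,2}=(L_0)_{x_i}$ for $i\in S$ and $E_{x_i,2}=(L_1)_{x_i}$ for $i\notin S$; (ii) with respect to this decomposition $\Phi=\begin{pmatrix}0&\alpha\\ \beta&0\end{pmatrix}$, where $\beta$ vanishes on the fibers over $x_i$ for $i\in S$ and $\alpha$ vanishes on the fibers over $x_i$ for $i\notin S$. Theorem. The fixed-point set of $\Theta$ is $$\mathcal H_{0,n}^{\mathbb R}=\bigcup_{1\in S\subset\{1,\dots,n\},\ 2\le|S|\le n-2}\mathcal Z_S .$$ Moreover,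 each of these sets $\mathcal Z_S$ is a non-compact (smooth, embedded) submanifold of $\mathcal H_0^n$ of real dimension $2(n-3)$, and $\mathcal H_{0,n}^{\mathbb R}$ has exactly $2^{n-1}-(n+1)$ connected components. -/

import Mathlib

open scoped Matrix Topology ContDiff Manifold

namespace QPH

/-- The Riemann sphere `ℂP¹`. -/
abbrev CP1 : Type := OnePoint ℂ

/-- The two standard holomorphic parametrizations of `ℂP¹` by `ℂ`: `z ↦ z` (for `false`) and
`w ↦ 1 / w`, `0 ↦ ∞` (for `true`). A map on `ℂP¹` is holomorphic iff its compositions with both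
of them are. -/
noncomputable def chartPt : Bool → ℂ → CP1
  | false, z => (z : OnePoint ℂ)
  | true, w => if w = 0 then OnePoint.infty else ((w⁻¹ : ℂ) : OnePoint ℂ)

/-- `L` is (the family of fibres of) a holomorphic line subbundle of degree `d` of the trivial
bundle `ℂP¹ × ℂ²`: it has nowhere vanishing holomorphic frames over the two standard charts, whose
transition function is that of `𝒪(d)`. (For `d = 0` the two frames agree on the overlap, so that
`L` has a nowhere vanishing holomorphic section, i.e. is trivial. The tautological subbundle, with
frames `(1, z)` and `(w, 1)`, has degree `-1`.) -/
def IsLineSubbundle (L : CP1 → Submodule ℂ (Fin 2 → ℂ)) (d : ℤ) : Prop :=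
  ∃ s : Bool → ℂ → (Fin 2 → ℂ),
    (∀ c, Differentiable ℂ (s c)) ∧ (∀ c ζ, s c ζ ≠ 0) ∧
    (∀ c ζ, L (chartPt c ζ) = Submodule.span ℂ {s c ζ}) ∧
    ∀ z : ℂ, z ≠ 0 → s false z = z ^ (-d) • s true z⁻¹

/-- A rank-2 quasi-parabolic `SL(2, ℂ)`-Higgs bundle over `ℂP¹` at the marked points `x i`, with
underlying holomorphic vector bundle the trivial bundle `E = ℂP¹ × ℂ²`.

The Higgs field is given by its local expressions `higgs false z dz` and `higgs true w dw` in the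
two charts; the values of these functions at the marked points are irrelevant. It is holomorphic
away from the marked points and has at most simple poles there, with residues `res i`. -/
structure Higgs {n : ℕ} (x : Fin n → CP1) where
  /-- the line `E_{x,2}` of the flag `E_x ⊃ E_{x,2} ⊃ 0` at the marked point `x i` -/
  flag : Fin n → Submodule ℂ (Fin 2 → ℂ)
  finrank_flag : ∀ i, Module.finrank ℂ (flag i) = 1
  higgs : Bool → ℂ → Matrix (Fin 2) (Fin 2) ℂ
  higgs_transition : ∀ w : ℂ, w ≠ 0 → chartPt true w ∉ Set.range x →
    higgs true w = (-(w ^ 2)⁻¹) • higgs false w⁻¹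
  higgs_holomorphic : ∀ c ζ, chartPt c ζ ∉ Set.range x →
    ∀ k l, DifferentiableAt ℂ (fun u => higgs c u k l) ζ
  higgs_trace : ∀ c ζ, chartPt c ζ ∉ Set.range x → (higgs c ζ).trace = 0
  res : Fin n → Matrix (Fin 2) (Fin 2) ℂ
  higgs_residue : ∀ i c ζ, chartPt c ζ = x i →
    Filter.Tendsto (fun u => (u - ζ) • higgs c u) (𝓝[≠] ζ) (𝓝 (res i))
  res_mem_flag : ∀ i v, res i *ᵥ v ∈ flag i
  res_flag_eq_zero : ∀ i, ∀ v ∈ flag i, res i *ᵥ v = 0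

/-- The quasi-parabolic slope of a bundle of degree `deg` and rank `rank` with a quasi-parabolic
structure at `card` points. -/
def parSlope (deg : ℤ) (card rank : ℕ) : ℚ :=
  ((deg : ℚ) + (1 / 2) * (card : ℚ) * (rank : ℚ)) / (rank : ℚ)

/-- The family of lines `L` is preserved by the Higgs field, `Φ(L) ⊂ L ⊗ K(D)`. -/
def Preserves {n : ℕ} {x : Fin n → CP1} (E : Higgs x) (L : CP1 → Submodule ℂ (Fin 2 → ℂ)) : Prop :=
  ∀ c ζ, chartPt c ζ ∉ Set.range x → ∀ v ∈ L (chartPt c ζ), E.higgs c ζ *ᵥ v ∈ L (chartPt c ζ)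

/-- Stability: all residues are nonzero, and each line subbundle `L` preserved by the Higgs field,
with its induced quasi-parabolic structure at any set `D'` of marked points over which `L` is the
line of the flag, has smaller quasi-parabolic slope than `E` (a trivial bundle, of degree `0`). -/
def IsStable {n : ℕ} {x : Fin n → CP1} (E : Higgs x) : Prop :=
  (∀ i, E.res i ≠ 0) ∧
  ∀ (L : CP1 → Submodule ℂ (Fin 2 → ℂ)) (d : ℤ) (D' : Finset (Fin n)),
    IsLineSubbundle L d → (∀ i ∈ D', L (x i) = E.flag i) → Preserves E L →
      parSlope d D'.card 1 < parSlope 0 n 2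

/-- `g`, a holomorphic automorphism of the bundle `ℂP¹ × ℂ²`, is an isomorphism of quasi-parabolic
Higgs bundles from `E` to `E'`. -/
structure IsIso {n : ℕ} {x : Fin n → CP1} (E E' : Higgs x)
    (g : CP1 → Matrix (Fin 2) (Fin 2) ℂ) : Prop where
  det_ne_zero : ∀ p, (g p).det ≠ 0
  holomorphic : ∀ c k l, Differentiable ℂ (fun ζ => g (chartPt c ζ) k l)
  flag_eq : ∀ i, E'.flag i = (E.flag i).map (g (x i)).mulVecLin
  higgs_comm : ∀ c ζ, chartPt c ζ ∉ Set.range x →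
    E'.higgs c ζ * g (chartPt c ζ) = g (chartPt c ζ) * E.higgs c ζ

theorem IsIso.refl {n : ℕ} {x : Fin n → CP1} (E : Higgs x) : IsIso E E (fun _ => 1) where
  det_ne_zero := by simp
  holomorphic := fun c k l => differentiable_const _
  flag_eq := by simp
  higgs_comm := by simp

theorem differentiable_inv_entry {f : ℂ → Matrix (Fin 2) (Fin 2) ℂ}
    (hd : ∀ z, (f z).det ≠ 0) (hf : ∀ k l, Differentiable ℂ (fun z => f z k l)) (k l : Fin 2) :
    Differentiable ℂ (fun z => (f z)⁻¹ k l) := by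
  have h1 : Differentiable ℂ (fun z => (f z).det) := by
    simp only [Matrix.det_fin_two]
    exact ((hf 0 0).mul (hf 1 1)).sub ((hf 0 1).mul (hf 1 0))
  have h2 : Differentiable ℂ (fun z => ((f z).det)⁻¹) := h1.inv hd
  have h3 : Differentiable ℂ (fun z => (f z).adjugate k l) := by
    fin_cases k <;> fin_cases l <;> simp [Matrix.adjugate_fin_two] <;> apply hf
  have h4 : (fun z => (f z)⁻¹ k l) = fun z => ((f z).det)⁻¹ * (f z).adjugate k l := by
    funext z
    simp [Matrix.inv_def, Ring.inverse_eq_inv']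
  rw [h4]
  exact h2.mul h3

theorem IsIso.symm {n : ℕ} {x : Fin n → CP1} {E E' : Higgs x}
    {g : CP1 → Matrix (Fin 2) (Fin 2) ℂ} (h : IsIso E E' g) :
    IsIso E' E (fun p => (g p)⁻¹) where
  det_ne_zero := fun p => by
    have := h.det_ne_zero p
    simpa [Matrix.det_nonsing_inv, Ring.inverse_eq_inv'] using this
  holomorphic := fun c k l =>
    differentiable_inv_entry (fun ζ => h.det_ne_zero (chartPt c ζ)) (h.holomorphic c) k l
  flag_eq := fun i => by
    have hu : IsUnit (g (x i)).det := (h.det_ne_zero (x i)).isUnit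
    rw [h.flag_eq i, ← Submodule.map_comp, ← Matrix.mulVecLin_mul, Matrix.nonsing_inv_mul _ hu]
    simp
  higgs_comm := fun c ζ hζ => by
    have hu : IsUnit (g (chartPt c ζ)).det := (h.det_ne_zero _).isUnit
    have h1 := h.higgs_comm c ζ hζ
    calc E.higgs c ζ * (g (chartPt c ζ))⁻¹
        = (g (chartPt c ζ))⁻¹ * (g (chartPt c ζ) * E.higgs c ζ) * (g (chartPt c ζ))⁻¹ := by
          rw [Matrix.nonsing_inv_mul_cancel_left _ _ hu]
      _ = (g (chartPt c ζ))⁻¹ * E'.higgs c ζ := by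
          rw [← h1, Matrix.mul_assoc, Matrix.mul_nonsing_inv_cancel_right _ _ hu]

theorem IsIso.trans {n : ℕ} {x : Fin n → CP1} {E E' E'' : Higgs x}
    {g g' : CP1 → Matrix (Fin 2) (Fin 2) ℂ} (h : IsIso E E' g) (h' : IsIso E' E'' g') :
    IsIso E E'' (fun p => g' p * g p) where
  det_ne_zero := fun p => by
    rw [Matrix.det_mul]
    exact mul_ne_zero (h'.det_ne_zero p) (h.det_ne_zero p)
  holomorphic := fun c k l => by
    simp only [Matrix.mul_apply, Fin.sum_univ_two]
    exact ((h'.holomorphic c _ _).mul (h.holomorphic c _ _)).add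
      ((h'.holomorphic c _ _).mul (h.holomorphic c _ _))
  flag_eq := fun i => by
    rw [h'.flag_eq i, h.flag_eq i, ← Submodule.map_comp, ← Matrix.mulVecLin_mul]
  higgs_comm := fun c ζ hζ => by
    rw [← Matrix.mul_assoc, h'.higgs_comm c ζ hζ, Matrix.mul_assoc, h.higgs_comm c ζ hζ,
      Matrix.mul_assoc]

/-- The stable quasi-parabolic `SL(2, ℂ)`-Higgs bundles with underlying bundle `ℂP¹ × ℂ²`. -/
def Stable {n : ℕ} (x : Fin n → CP1) : Type := {E : Higgs x // IsStable E}

instance stableSetoid {n : ℕ} (x : Fin n → CP1) : Setoid (Stable x) where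
  r E E' := ∃ g, IsIso E.1 E'.1 g
  iseqv :=
    { refl := fun E => ⟨_, IsIso.refl E.1⟩
      symm := fun ⟨_, h⟩ => ⟨_, h.symm⟩
      trans := fun ⟨_, h⟩ ⟨_, h'⟩ => ⟨_, h.trans h'⟩ }

/-- The residues of the Higgs field. They determine the Higgs field, and, for a stable Higgs
bundle, also the flags (the line of the flag is the kernel of the residue); so these are global
coordinates on the set of stable Higgs bundles. -/
def residues {n : ℕ} {x : Fin n → CP1} (E : Stable x) : Fin n → Fin 2 → Fin 2 → ℂ :=
  fun i k l => E.1.res i k l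

noncomputable instance stableTopology {n : ℕ} (x : Fin n → CP1) : TopologicalSpace (Stable x) :=
  TopologicalSpace.induced residues inferInstance

/-- The moduli space `ℋ₀ⁿ`: isomorphism classes of stable rank-2 quasi-parabolic
`SL(2, ℂ)`-Higgs bundles with trivial underlying bundle, with the quotient topology. -/
def Moduli {n : ℕ} (x : Fin n → CP1) : Type := Quotient (stableSetoid x)

noncomputable instance moduliTopology {n : ℕ} (x : Fin n → CP1) : TopologicalSpace (Moduli x) :=
  inferInstanceAs (TopologicalSpace (Quotient (stableSetoid x)))

/-- The isomorphism class of a stable Higgs bundle. -/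
def Moduli.mk {n : ℕ} {x : Fin n → CP1} (E : Stable x) : Moduli x := Quotient.mk _ E

/-- The annihilator of a subspace of `ℂ²` in the dual space, which is identified with `ℂ²` by the
dual basis. -/
def annihilator (l : Submodule ℂ (Fin 2 → ℂ)) : Submodule ℂ (Fin 2 → ℂ) where
  carrier := {f | ∀ v ∈ l, f ⬝ᵥ v = 0}
  zero_mem' := by simp
  add_mem' := fun ha hb v hv => by simp [add_dotProduct, ha v hv, hb v hv]
  smul_mem' := fun c f hf v hv => by simp [smul_dotProduct, hf v hv]

theorem mem_annihilator {l : Submodule ℂ (Fin 2 → ℂ)} {f : Fin 2 → ℂ} :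
    f ∈ annihilator l ↔ ∀ v ∈ l, f ⬝ᵥ v = 0 := Iff.rfl

theorem exists_span_of_finrank {l : Submodule ℂ (Fin 2 → ℂ)} (h : Module.finrank ℂ l = 1) :
    ∃ v : Fin 2 → ℂ, v ≠ 0 ∧ l = Submodule.span ℂ {v} := by
  obtain ⟨⟨v, hv⟩, hv0, hs⟩ := finrank_eq_one_iff'.1 h
  refine ⟨v, fun h0 => hv0 (Subtype.ext h0), le_antisymm ?_ ?_⟩
  · intro w hw
    obtain ⟨c, hc⟩ := hs ⟨w, hw⟩
    exact Submodule.mem_span_singleton.2 ⟨c, congrArg Subtype.val hc⟩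
  · rw [Submodule.span_singleton_le_iff_mem]
    exact hv

/-- Rotation by a right angle, as a linear map of `ℂ²`. -/
noncomputable def rot : (Fin 2 → ℂ) →ₗ[ℂ] (Fin 2 → ℂ) := (!![0, -1; 1, 0] : Matrix (Fin 2) (Fin 2) ℂ).mulVecLin

theorem rot_apply (v : Fin 2 → ℂ) : rot v = ![-v 1, v 0] := by
  funext k
  fin_cases k <;> simp [rot, Matrix.mulVec, dotProduct, Fin.sum_univ_two]

theorem rot_ne_zero {v : Fin 2 → ℂ} (hv : v ≠ 0) : rot v ≠ 0 := by
  intro h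
  apply hv
  rw [rot_apply] at h
  have h0 := congrFun h 0
  have h1 := congrFun h 1
  funext k
  fin_cases k <;> simp_all

theorem annihilator_span {v : Fin 2 → ℂ} (hv : v ≠ 0) :
    annihilator (Submodule.span ℂ {v}) = Submodule.span ℂ {rot v} := by
  ext f
  rw [mem_annihilator, Submodule.mem_span_singleton]
  have hr : rot v = ![-v 1, v 0] := rot_apply v
  constructor
  · intro h
    have hf := h v (Submodule.mem_span_singleton_self v)
    simp only [dotProduct, Fin.sum_univ_two] at hf
    by_cases h0 : v 0 = 0
    · have h1 : v 1 ≠ 0 := fun h1 => hv (by funext k; fin_cases k <;> simp [h0, h1])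
      refine ⟨-(f 0 / v 1), ?_⟩
      have hf1 : f 1 = 0 := by simpa [h0, h1] using hf
      rw [hr]
      funext k
      fin_cases k
      · simp [h1]
      · simp [h0, hf1]
    · refine ⟨f 1 / v 0, ?_⟩
      rw [hr]
      funext k
      fin_cases k
      · simp only [Fin.zero_eta, Pi.smul_apply, Matrix.cons_val_zero, smul_eq_mul]
        field_simp
        linear_combination (-1 : ℂ) * hf
      · simp [h0]
  · rintro ⟨c, rfl⟩ w hw
    obtain ⟨a, rfl⟩ := Submodule.mem_span_singleton.1 hw
    rw [hr]
    simp only [dotProduct, Fin.sum_univ_two, Pi.smul_apply, Matrix.cons_val_zero,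
      Matrix.cons_val_one, smul_eq_mul]
    ring

theorem finrank_annihilator {l : Submodule ℂ (Fin 2 → ℂ)} (h : Module.finrank ℂ l = 1) :
    Module.finrank ℂ (annihilator l) = 1 := by
  obtain ⟨v, hv, rfl⟩ := exists_span_of_finrank h
  rw [annihilator_span hv]
  exact finrank_span_singleton (rot_ne_zero hv)

theorem annihilator_annihilator {l : Submodule ℂ (Fin 2 → ℂ)} (h : Module.finrank ℂ l = 1) :
    annihilator (annihilator l) = l := by
  obtain ⟨v, hv, rfl⟩ := exists_span_of_finrank h
  rw [annihilator_span hv, annihilator_span (rot_ne_zero hv)]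
  have : rot (rot v) = -v := by
    rw [rot_apply, rot_apply]
    funext k
    fin_cases k <;> simp
  rw [this, ← Set.neg_singleton, Submodule.span_neg]

theorem transpose_mulVec_dotProduct (A : Matrix (Fin 2) (Fin 2) ℂ) (f v : Fin 2 → ℂ) :
    (Aᵀ *ᵥ f) ⬝ᵥ v = f ⬝ᵥ (A *ᵥ v) := by
  rw [Matrix.mulVec_transpose, Matrix.dotProduct_mulVec]

/-- The dual `(E^*, Φ^t)`: the dual bundle, trivialized by the dual basis, with the dual flags
(annihilators) and the transposed Higgs field. -/
def Higgs.dual {n : ℕ} {x : Fin n → CP1} (E : Higgs x) : Higgs x where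
  flag i := annihilator (E.flag i)
  finrank_flag i := finrank_annihilator (E.finrank_flag i)
  higgs c ζ := (E.higgs c ζ)ᵀ
  higgs_transition := fun w hw hx => by
    rw [E.higgs_transition w hw hx, Matrix.transpose_smul]
  higgs_holomorphic := fun c ζ hx k l => E.higgs_holomorphic c ζ hx l k
  higgs_trace := fun c ζ hx => by rw [Matrix.trace_transpose, E.higgs_trace c ζ hx]
  res i := (E.res i)ᵀ
  higgs_residue := fun i c ζ hx => by
    have h := (Continuous.matrix_transpose continuous_id).continuousAt.tendsto.comp
      (E.higgs_residue i c ζ hx)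
    simpa [Function.comp_def, Matrix.transpose_smul] using h
  res_mem_flag := fun i f v hv => by
    rw [transpose_mulVec_dotProduct, E.res_flag_eq_zero i v hv, dotProduct_zero]
  res_flag_eq_zero := fun i f hf => by
    rw [← dotProduct_eq_zero_iff]
    intro v
    rw [transpose_mulVec_dotProduct]
    exact hf _ (E.res_mem_flag i v)

theorem IsLineSubbundle.annihilator {L : CP1 → Submodule ℂ (Fin 2 → ℂ)} {d : ℤ}
    (h : IsLineSubbundle L d) : IsLineSubbundle (fun p => annihilator (L p)) d := by
  obtain ⟨s, hs, h0, hL, ht⟩ := h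
  refine ⟨fun c ζ => rot (s c ζ), fun c => ?_, fun c ζ => rot_ne_zero (h0 c ζ), fun c ζ => ?_,
    fun z hz => ?_⟩
  · exact (LinearMap.toContinuousLinearMap rot).differentiable.comp (hs c)
  · simp only [hL, annihilator_span (h0 c ζ)]
  · simp only [ht z hz, map_smul]

theorem exists_chartPt (p : CP1) : ∃ c ζ, chartPt c ζ = p := by
  induction p using OnePoint.rec with
  | infty => exact ⟨true, 0, by simp [chartPt]⟩
  | coe z => exact ⟨false, z, rfl⟩

theorem IsStable.dual {n : ℕ} {x : Fin n → CP1} {E : Higgs x} (h : IsStable E) :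
    IsStable E.dual := by
  refine ⟨fun i h0 => h.1 i (Matrix.transpose_eq_zero.1 h0), fun L d D' hL hD hP => ?_⟩
  refine h.2 (fun p => annihilator (L p)) d D' hL.annihilator (fun i hi => ?_) ?_
  · have h1 : L (x i) = annihilator (E.flag i) := hD i hi
    simp only [h1, annihilator_annihilator (E.finrank_flag i)]
  · intro c ζ hx v hv f hf
    have h1 : f ⬝ᵥ (E.higgs c ζ *ᵥ v) = 0 := by
      rw [← transpose_mulVec_dotProduct, dotProduct_comm]
      exact hv _ (hP c ζ hx f hf)
    rw [dotProduct_comm]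
    exact h1

theorem IsIso.dual {n : ℕ} {x : Fin n → CP1} {E E' : Higgs x}
    {g : CP1 → Matrix (Fin 2) (Fin 2) ℂ} (h : IsIso E E' g) :
    IsIso E.dual E'.dual (fun p => ((g p)⁻¹)ᵀ) where
  det_ne_zero := fun p => by
    rw [Matrix.det_transpose]
    exact h.symm.det_ne_zero p
  holomorphic := fun c k l => h.symm.holomorphic c l k
  flag_eq := fun i => by
    have hu : IsUnit (g (x i)).det := (h.det_ne_zero (x i)).isUnit
    change annihilator (E'.flag i) = (annihilator (E.flag i)).map _
    rw [h.flag_eq i]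
    ext f
    rw [Submodule.mem_map]
    constructor
    · intro hf
      refine ⟨(g (x i))ᵀ *ᵥ f, fun v hv => ?_, ?_⟩
      · rw [transpose_mulVec_dotProduct]
        exact hf _ (Submodule.mem_map_of_mem hv)
      · rw [Matrix.mulVecLin_apply, Matrix.mulVec_mulVec, ← Matrix.transpose_mul,
          Matrix.mul_nonsing_inv _ hu]
        simp
    · rintro ⟨f, hf, rfl⟩ w hw
      obtain ⟨v, hv, rfl⟩ := Submodule.mem_map.1 hw
      rw [Matrix.mulVecLin_apply, Matrix.mulVecLin_apply, transpose_mulVec_dotProduct,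
        Matrix.mulVec_mulVec, Matrix.nonsing_inv_mul _ hu, Matrix.one_mulVec]
      exact hf v hv
  higgs_comm := fun c ζ hx => by
    change (E'.higgs c ζ)ᵀ * _ = _ * (E.higgs c ζ)ᵀ
    rw [← Matrix.transpose_mul, ← Matrix.transpose_mul, h.symm.higgs_comm c ζ hx]

/-- The involution `Θ : (E, Φ) ↦ (E^*, Φ^t)` of the moduli space. -/
def Theta {n : ℕ} {x : Fin n → CP1} : Moduli x → Moduli x :=
  Quotient.map (fun E => ⟨E.1.dual, E.2.dual⟩) (fun _ _ ⟨_, h⟩ => ⟨_, h.dual⟩)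

/-- `(E, Φ)` is a quasi-parabolic `SL(2, ℝ)`-Higgs bundle of type `S`: `E = L₀ ⊕ L₁` with `L₀`,
`L₁` trivial line bundles; the lines of the flags are the fibres of `L₀` over the marked points
with index in `S` and those of `L₁` over the other ones; the Higgs field is off-diagonal,
`Φ = (0, α; β, 0)` with `α : L₁ → L₀ ⊗ K(D)`, `β : L₀ → L₁ ⊗ K(D)`; and (as a section of
`Hom(E, E) ⊗ K(D)`, whose value at a marked point is the residue) it has `β = 0` over the marked
points with index in `S` and `α = 0` over the other ones. -/
def IsRealType {n : ℕ} {x : Fin n → CP1} (S : Finset (Fin n)) (E : Higgs x) : Prop :=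
  ∃ L₀ L₁ : CP1 → Submodule ℂ (Fin 2 → ℂ),
    IsLineSubbundle L₀ 0 ∧ IsLineSubbundle L₁ 0 ∧ (∀ p, IsCompl (L₀ p) (L₁ p)) ∧
    (∀ i ∈ S, E.flag i = L₀ (x i)) ∧ (∀ i ∉ S, E.flag i = L₁ (x i)) ∧
    (∀ c ζ, chartPt c ζ ∉ Set.range x →
      (∀ v ∈ L₀ (chartPt c ζ), E.higgs c ζ *ᵥ v ∈ L₁ (chartPt c ζ)) ∧
      (∀ v ∈ L₁ (chartPt c ζ), E.higgs c ζ *ᵥ v ∈ L₀ (chartPt c ζ))) ∧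
    (∀ i ∈ S, (∀ v ∈ L₁ (x i), E.res i *ᵥ v ∈ L₀ (x i)) ∧ ∀ v ∈ L₀ (x i), E.res i *ᵥ v = 0) ∧
    (∀ i ∉ S, (∀ v ∈ L₀ (x i), E.res i *ᵥ v ∈ L₁ (x i)) ∧ ∀ v ∈ L₁ (x i), E.res i *ᵥ v = 0)

/-- The set `𝒵_S ⊂ ℋ₀ⁿ`. -/
def ZSet {n : ℕ} (x : Fin n → CP1) (S : Finset (Fin n)) : Set (Moduli x) :=
  {q | ∃ E : Stable x, Moduli.mk E = q ∧ IsRealType S E.1}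

/-- A local chart `e` of a subset `Z` of the moduli space (with the subspace topology) is smooth:
locally, the coordinates of the class of `E` are restrictions of `C^∞` functions of the residues
of `E` (that is, of functions on an open set of the ambient space of tuples of matrices), and the
inverse of `e` is the classifying map of `C^∞` families of stable Higgs bundles. For two smooth
charts the transition map is smooth, and a subset that is covered by smooth charts is an embedded
submanifold of the moduli space with its quotient smooth structure. -/
def IsSmoothChart {n : ℕ} {x : Fin n → CP1} {Z : Set (Moduli x)} {d : ℕ}
    (e : OpenPartialHomeomorph Z (EuclideanSpace ℝ (Fin d))) : Prop :=
  (∀ (E : Stable x) (hE : Moduli.mk E ∈ Z), (⟨Moduli.mk E, hE⟩ : Z) ∈ e.source →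
    ∃ U : Set (Fin n → Fin 2 → Fin 2 → ℂ), IsOpen U ∧ residues E ∈ U ∧
      ∃ F : (Fin n → Fin 2 → Fin 2 → ℂ) → EuclideanSpace ℝ (Fin d), ContDiffOn ℝ ∞ F U ∧
        ∀ (E' : Stable x) (hE' : Moduli.mk E' ∈ Z), (⟨Moduli.mk E', hE'⟩ : Z) ∈ e.source →
          residues E' ∈ U → e ⟨Moduli.mk E', hE'⟩ = F (residues E')) ∧
  (∀ y ∈ e.target, ∃ V : Set (EuclideanSpace ℝ (Fin d)), IsOpen V ∧ y ∈ V ∧ V ⊆ e.target ∧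
    ∃ s : EuclideanSpace ℝ (Fin d) → Stable x, ContDiffOn ℝ ∞ (fun t => residues (s t)) V ∧
      ∀ t ∈ V, Moduli.mk (s t) = (e.symm t : Moduli x))

/-- The subset `Z` of the moduli space is a smooth (embedded) submanifold of dimension `d`:
Hausdorff, second countable, and with an atlas of smooth charts with values in `ℝᵈ`. -/
def IsSubmanifoldOfDim {n : ℕ} {x : Fin n → CP1} (Z : Set (Moduli x)) (d : ℕ) : Prop :=
  T2Space Z ∧ SecondCountableTopology Z ∧
    ∃ cs : ChartedSpace (EuclideanSpace ℝ (Fin d)) Z, IsManifold (𝓡 d) ∞ Z ∧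
      ∀ e ∈ cs.atlas, IsSmoothChart e

end QPH

/-! By Liouville's theorem, holomorphic functions on `ℂP¹` are constant and a Higgs field is the sum
of its simple polar parts, with residues summing to zero (`Higgs.entry_eq`). Isomorphisms are
therefore constant matrices. For nonzero residues the flags are their kernels, so the moduli space
consists of tuples of nonzero square-zero matrices with sum zero, up to simultaneous conjugation
(`mk_eq_mk_iff`). Line subbundles have degree at most 0, and those of degree 0 are constant;
stability then says only that the residues are nonzero and the flags are not all equal
(`isStable_iff`).

A class is fixed by `Theta` when a single matrix `K` conjugates every residue to its transpose. With
`J` the rotation by a right angle, a traceless `A` satisfies `Aᵀ J = -J A`, so `K J` anticommutes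
with all residues. Each flag is then an eigenline of `K J`, and only two eigenlines occur. In a
frame adapted to them every residue has one nonzero entry `a i`, above the diagonal for `i ∈ S` and
below it otherwise (`IsNormalForm`). Conversely, swapping the two basis vectors transposes such
matrices. The residue theorem becomes the vanishing of the sums of `a` over `S` and over its
complement; as no `a i` is zero, both sets have at least two elements. Swapping the two lines
replaces `S` by its complement, which is why a base index is required to lie in `S`.

The frame is unique up to a diagonal matrix, which multiplies `a` by a constant on `S` and by its
inverse off `S`. Setting one coefficient in `S` to 1 and solving the two sum conditions leaves `n -
3` free complex numbers, subject to all coefficients being nonzero. The traces of products of two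
residues recover these numbers, so `𝒵_S` is homeomorphic to the complement of finitely many affine
hyperplanes in `ℂ^(n-3)` (`Pivots.IsFamily.homeomorph`). This gives a global chart, connectedness
and non-compactness. The same traces show that the sets `𝒵_S` are disjoint and open in the
fixed-point set, so they are its components, and counting subsets finishes the proof. -/

namespace QPH

/-! ### Liouville's theorem, removable singularities and line subbundles -/

/-- A version of Liouville's theorem: an entire function that extends continuously to `∞` is
constant. -/
theorem eq_of_eventually_inv {F : Type*} [NormedAddCommGroup F] [NormedSpace ℂ F]
    {f u : ℂ → F} (hf : Differentiable ℂ f) (hu : ContinuousAt u 0)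
    (h : ∀ᶠ w in 𝓝[≠] 0, f w⁻¹ = u w) (z : ℂ) : f z = u 0 := by
  refine hf.apply_eq_of_tendsto_cocompact z ?_
  rw [← Metric.cobounded_eq_cocompact]
  have h1 : Filter.Tendsto (fun w => f w⁻¹) (𝓝[≠] 0) (𝓝 (u 0)) :=
    (hu.tendsto.mono_left nhdsWithin_le_nhds).congr' (h.mono fun _ hw => hw.symm)
  have h2 := h1.comp Filter.tendsto_inv₀_cobounded'
  simpa [Function.comp_def] using h2

/-- A function that is holomorphic off a finite set and whose singularities are weaker than simple
poles extends to an entire function. -/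
theorem exists_entire_of_finite {f : ℂ → ℂ} {s : Set ℂ} (hs : s.Finite)
    (hf : ∀ z ∉ s, DifferentiableAt ℂ f z)
    (hl : ∀ z ∈ s, Filter.Tendsto (fun u => (u - z) * f u) (𝓝[≠] z) (𝓝 0)) :
    ∃ g : ℂ → ℂ, Differentiable ℂ g ∧ ∀ z ∉ s, g z = f z := by
  induction s, hs using Set.Finite.induction_on generalizing f with
  | empty => exact ⟨f, fun z => hf z (by simp), fun _ _ => rfl⟩
  | @insert a s ha hs ih =>
    have hev : ∀ z, ∀ᶠ u in 𝓝[≠] z, u ∉ insert a s := by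
      intro z
      have h1 := ((hs.insert a).subset Set.sdiff_subset : (insert a s \ {z}).Finite)
      have h2 : (insert a s \ {z})ᶜ ∈ 𝓝 z := h1.isClosed.isOpen_compl.mem_nhds (by simp)
      filter_upwards [nhdsWithin_le_nhds h2, self_mem_nhdsWithin] with u hu hu' hu''
      exact hu ⟨hu'', hu'⟩
    set g := Function.update f a ((𝓝[≠] a).limUnder f) with hg
    have hne : ∀ z, z ≠ a → g =ᶠ[𝓝 z] f := by
      intro z hz
      filter_upwards [isOpen_ne.mem_nhds hz] with u hu
      exact Function.update_of_ne hu _ _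
    have hga : DifferentiableAt ℂ g a := by
      have h1 : {u | u ≠ a → u ∉ insert a s} ∈ 𝓝 a := by
        exact eventually_nhdsWithin_iff.1 (hev a)
      have h2 : DifferentiableOn ℂ f ({u | u ≠ a → u ∉ insert a s} \ {a}) := fun u hu =>
        (hf u (hu.1 hu.2)).differentiableWithinAt
      refine (Complex.differentiableOn_update_limUnder_of_isLittleO h1 h2 ?_).differentiableAt h1
      have h3 := hl a (Set.mem_insert _ _)
      -- The value `f a` is arbitrary, but Riemann's criterion is phrased with `f u - f a`;
      -- multiplied by `u - a`, the constant is negligible.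
      have h4 : Filter.Tendsto (fun u => (u - a) * (f u - f a)) (𝓝[≠] a) (𝓝 0) := by
        have h5 : Filter.Tendsto (fun u : ℂ => (u - a) * f a) (𝓝[≠] a) (𝓝 0) := by
          have : ContinuousAt (fun u : ℂ => (u - a) * f a) a := by fun_prop
          simpa using this.tendsto.mono_left nhdsWithin_le_nhds
        simpa [mul_sub] using h3.sub h5
      rw [Asymptotics.isLittleO_iff_tendsto']
      · refine h4.congr' ?_
        filter_upwards with u
        rw [div_inv_eq_mul, mul_comm]
      · filter_upwards [self_mem_nhdsWithin] with u hu h0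
        exact absurd (inv_eq_zero.1 h0) (sub_ne_zero.2 hu)
    obtain ⟨G, hG, hG'⟩ := ih (f := g) (fun z hz => by
        by_cases hza : z = a
        · rw [hza]; exact hga
        · exact (hf z (by simp [hza, hz])).congr_of_eventuallyEq (hne z hza))
      (fun z hz => by
        have hza : z ≠ a := fun h => ha (h ▸ hz)
        refine (hl z (Set.mem_insert_of_mem _ hz)).congr' ?_
        filter_upwards [nhdsWithin_le_nhds (hne z hza)] with u hu
        rw [hu])
    refine ⟨G, hG, fun z hz => ?_⟩
    simp only [Set.mem_insert_iff, not_or] at hz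
    rw [hG' z hz.2, hg, Function.update_of_ne hz.1]

theorem chartPt_injective (c : Bool) : Function.Injective (chartPt c) := by
  cases c
  · exact OnePoint.coe_injective
  · intro z w h
    simp only [chartPt] at h
    split_ifs at h with h1 h2 h2
    · rw [h1, h2]
    · exact absurd h.symm (OnePoint.coe_ne_infty _)
    · exact absurd h (OnePoint.coe_ne_infty _)
    · exact inv_injective (OnePoint.coe_injective h)

theorem chartPt_true_inv {z : ℂ} (hz : z ≠ 0) : chartPt true z⁻¹ = chartPt false z := by
  simp [chartPt, hz]

theorem chartPt_true_of_ne {z : ℂ} (hz : z ≠ 0) : chartPt true z = chartPt false z⁻¹ := by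
  simp [chartPt, hz]

/-- A holomorphic function on `ℂP¹` is constant. -/
theorem eq_of_holomorphic {f : CP1 → ℂ} (hf : ∀ c, Differentiable ℂ fun ζ => f (chartPt c ζ))
    (p : CP1) : f p = f (chartPt true 0) := by
  have h1 : ∀ z, f (chartPt false z) = f (chartPt true 0) :=
    eq_of_eventually_inv (u := fun w => f (chartPt true w)) (hf false)
      (hf true).continuous.continuousAt (by
        filter_upwards [self_mem_nhdsWithin] with w hw
        rw [chartPt_true_of_ne hw])
  induction p using OnePoint.rec with
  | infty => simp [chartPt]
  | coe z => exact h1 z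

/-- Line subbundles of the trivial bundle have nonpositive degree. -/
theorem IsLineSubbundle.degree_nonpos {L : CP1 → Submodule ℂ (Fin 2 → ℂ)} {d : ℤ}
    (h : IsLineSubbundle L d) : d ≤ 0 := by
  obtain ⟨s, hs, h0, -, ht⟩ := h
  by_contra! hd
  obtain ⟨k, rfl⟩ := Int.eq_ofNat_of_zero_le hd.le
  have hk : k ≠ 0 := by rintro rfl; simp at hd
  refine h0 false 0 ?_
  -- The finite frame at `w⁻¹` equals `w ^ k • s true w`, which extends by zero to `w = 0` because
  -- `k > 0`; Liouville makes the frame vanish identically.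
  rw [eq_of_eventually_inv (u := fun w => w ^ k • s true w) (hs false)
    ((continuous_id.pow k).smul (hs true).continuous).continuousAt, zero_pow hk, zero_smul]
  filter_upwards [self_mem_nhdsWithin] with w hw
  rw [ht _ (inv_ne_zero hw)]
  simp

/-- Line subbundles of degree `0` of the trivial bundle are constant. -/
theorem IsLineSubbundle.exists_eq_span {L : CP1 → Submodule ℂ (Fin 2 → ℂ)}
    (h : IsLineSubbundle L 0) : ∃ v, v ≠ 0 ∧ ∀ p, L p = Submodule.span ℂ {v} := by
  obtain ⟨s, hs, h0, hL, ht⟩ := h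
  have h1 : ∀ z, s false z = s true 0 := eq_of_eventually_inv (hs false)
    (hs true).continuous.continuousAt (by
      filter_upwards [self_mem_nhdsWithin] with w hw
      simpa using ht _ (inv_ne_zero hw))
  refine ⟨s true 0, h0 true 0, fun p => ?_⟩
  induction p using OnePoint.rec with
  | infty => rw [← hL]; simp [chartPt]
  | coe z => rw [← h1 z, ← hL]; rfl

theorem isLineSubbundle_const {v : Fin 2 → ℂ} (hv : v ≠ 0) :
    IsLineSubbundle (fun _ => Submodule.span ℂ {v}) 0 :=
  ⟨fun _ _ => v, fun _ => differentiable_const _, fun _ _ => hv, fun _ _ => rfl, by simp⟩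

/-! ### Simple poles in the two charts -/

open Classical in
/-- The function `(u - ζ)⁻¹` of the local coordinate `u` in the chart `c`, where `ζ` is the
coordinate of the point `p`; it is `0` if `p` is not in the domain of the chart. -/
noncomputable def poleFun (c : Bool) (p : CP1) (u : ℂ) : ℂ :=
  if h : ∃ ζ, chartPt c ζ = p then (u - h.choose)⁻¹ else 0

theorem poleFun_chartPt (c : Bool) (ζ u : ℂ) : poleFun c (chartPt c ζ) u = (u - ζ)⁻¹ := by
  have h : ∃ η, chartPt c η = chartPt c ζ := ⟨ζ, rfl⟩
  rw [poleFun, dif_pos h, chartPt_injective c h.choose_spec]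

theorem poleFun_of_notMem {c : Bool} {p : CP1} (h : ∀ ζ, chartPt c ζ ≠ p) (u : ℂ) :
    poleFun c p u = 0 := by
  rw [poleFun, dif_neg (by simpa using h)]

theorem poleFun_differentiableAt {c : Bool} {p : CP1} {u : ℂ} (h : chartPt c u ≠ p) :
    DifferentiableAt ℂ (poleFun c p) u := by
  by_cases hp : ∃ ζ, chartPt c ζ = p
  · obtain ⟨ζ, rfl⟩ := hp
    have h1 : poleFun c (chartPt c ζ) = fun u => (u - ζ)⁻¹ := funext (poleFun_chartPt c ζ)
    rw [h1]
    have h2 : u - ζ ≠ 0 := fun h0 => h (by rw [sub_eq_zero.1 h0])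
    fun_prop (disch := assumption)
  · push Not at hp
    have h1 : poleFun c p = fun _ => 0 := funext (poleFun_of_notMem hp)
    rw [h1]
    exact differentiableAt_const _

/-- A 1-form on `ℂP¹` cannot have exactly one simple pole: `dz / (z - a)` also has one at `∞`. The
term `w⁻¹` measures this failure, and it does not depend on `p`. -/
theorem poleFun_transition {w : ℂ} (hw : w ≠ 0) {p : CP1} (hp : chartPt true w ≠ p) :
    poleFun true p w + (w ^ 2)⁻¹ * poleFun false p w⁻¹ = w⁻¹ := by
  induction p using OnePoint.rec with
  | infty =>
    have h1 : (OnePoint.infty : CP1) = chartPt true 0 := by simp [chartPt]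
    rw [poleFun_of_notMem (c := false) fun ζ => OnePoint.coe_ne_infty ζ, h1, poleFun_chartPt]
    simp
  | coe a =>
    have h1 : ((a : ℂ) : CP1) = chartPt false a := rfl
    rw [h1, poleFun_chartPt]
    rw [h1] at hp
    by_cases ha : a = 0
    · subst ha
      rw [poleFun_of_notMem]
      · field_simp
        simp
      · intro ζ h
        simp only [chartPt] at h
        split_ifs at h with h2
        · exact OnePoint.coe_ne_infty _ h.symm
        · exact h2 (inv_eq_zero.1 (OnePoint.coe_injective h))
    · rw [← chartPt_true_inv ha, poleFun_chartPt]
      have h2 : w * a - 1 ≠ 0 := fun h0 => hp (by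
        rw [chartPt_true_of_ne hw]
        congr 1
        exact (eq_inv_of_mul_eq_one_right (sub_eq_zero.1 h0)).symm)
      have h3 : w - a⁻¹ = (w * a - 1) / a := by field_simp
      have h4 : w⁻¹ - a = -(w * a - 1) / w := by field_simp; ring
      rw [h3, h4]
      field_simp
      ring

theorem tendsto_mul_poleFun (c : Bool) (ζ : ℂ) :
    Filter.Tendsto (fun u => (u - ζ) * poleFun c (chartPt c ζ) u) (𝓝[≠] ζ) (𝓝 1) := by
  refine tendsto_const_nhds.congr' ?_
  filter_upwards [self_mem_nhdsWithin] with u hu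
  rw [poleFun_chartPt, mul_inv_cancel₀ (sub_ne_zero.2 hu)]

theorem tendsto_mul_poleFun_of_ne {c : Bool} {ζ : ℂ} {p : CP1} (h : chartPt c ζ ≠ p) :
    Filter.Tendsto (fun u => (u - ζ) * poleFun c p u) (𝓝[≠] ζ) (𝓝 0) := by
  have h1 : ContinuousAt (fun u => (u - ζ) * poleFun c p u) ζ :=
    (by fun_prop : ContinuousAt (fun u : ℂ => u - ζ) ζ).mul (poleFun_differentiableAt h).continuousAt
  simpa using h1.tendsto.mono_left nhdsWithin_le_nhds

/-! ### Higgs fields are determined by their residues -/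

variable {n : ℕ} {x : Fin n → CP1}

theorem finite_preimage_range (x : Fin n → CP1) (c : Bool) : (chartPt c ⁻¹' Set.range x).Finite :=
  (Set.finite_range x).preimage (chartPt_injective c).injOn

theorem eventually_notMem_range (x : Fin n → CP1) (c : Bool) (ζ : ℂ) :
    ∀ᶠ u in 𝓝[≠] ζ, chartPt c u ∉ Set.range x := by
  have h1 := ((finite_preimage_range x c).subset Set.sdiff_subset :
    ((chartPt c ⁻¹' Set.range x) \ {ζ}).Finite)
  have h2 : ((chartPt c ⁻¹' Set.range x) \ {ζ})ᶜ ∈ 𝓝 ζ :=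
    h1.isClosed.isOpen_compl.mem_nhds (by simp)
  filter_upwards [nhdsWithin_le_nhds h2, self_mem_nhdsWithin] with u hu hu' hu''
  exact hu ⟨hu'', hu'⟩

theorem tendsto_mul_sum_poleFun (hx : Function.Injective x) {i : Fin n} {c : Bool} {ζ : ℂ}
    (h : chartPt c ζ = x i) (a : Fin n → ℂ) :
    Filter.Tendsto (fun u => (u - ζ) * ∑ j, poleFun c (x j) u * a j) (𝓝[≠] ζ) (𝓝 (a i)) := by
  have h1 : ∀ j ∈ Finset.univ, Filter.Tendsto (fun u => (u - ζ) * poleFun c (x j) u * a j)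
      (𝓝[≠] ζ) (𝓝 (if j = i then a j else 0)) := by
    intro j _
    split_ifs with hj
    · subst hj
      simpa [h] using (tendsto_mul_poleFun c ζ).mul_const (a j)
    · have h2 : chartPt c ζ ≠ x j := fun h3 => hj (hx (h3.symm.trans h))
      simpa using (tendsto_mul_poleFun_of_ne h2).mul_const (a j)
  have h3 := tendsto_finsetSum Finset.univ h1
  simpa [Finset.mul_sum, mul_assoc] using h3

theorem sum_poleFun_transition {w : ℂ} (hw : w ≠ 0) (hp : chartPt true w ∉ Set.range x)
    (a : Fin n → ℂ) :
    ∑ i, poleFun true (x i) w * a i =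
      -(w ^ 2)⁻¹ * ∑ i, poleFun false (x i) w⁻¹ * a i + w⁻¹ * ∑ i, a i := by
  rw [Finset.mul_sum, Finset.mul_sum, ← Finset.sum_add_distrib]
  refine Finset.sum_congr rfl fun i _ => ?_
  have h := poleFun_transition hw (p := x i) fun h => hp ⟨i, h.symm⟩
  linear_combination a i * h

/-- After subtraction of the polar parts, entire functions `H c` remain, related by `H false w⁻¹ =
-w² H true w - w ∑ res`. The right side tends to 0 at `w = 0`, so `H false` vanishes. Dividing by
`w` and letting `w → 0` gives the residue theorem, and then `H true` vanishes too. -/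
theorem Higgs.entry_eq (hx : Function.Injective x) (E : Higgs x) (k l : Fin 2) :
    ∑ i, E.res i k l = 0 ∧ ∀ c ζ, chartPt c ζ ∉ Set.range x →
      E.higgs c ζ k l = ∑ i, poleFun c (x i) ζ * E.res i k l := by
  have key : ∀ c, ∃ g : ℂ → ℂ, Differentiable ℂ g ∧ ∀ z ∉ chartPt c ⁻¹' Set.range x,
      g z = E.higgs c z k l - ∑ i, poleFun c (x i) z * E.res i k l := by
    intro c
    refine exists_entire_of_finite (finite_preimage_range x c) (fun z hz => ?_) ?_
    · refine (E.higgs_holomorphic c z hz k l).sub ?_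
      refine DifferentiableAt.fun_sum fun i _ => ?_
      exact (poleFun_differentiableAt fun h => hz ⟨i, h.symm⟩).mul_const _
    · rintro z ⟨i, hi⟩
      have h1 : Filter.Tendsto (fun u => (u - z) * E.higgs c u k l) (𝓝[≠] z) (𝓝 (E.res i k l)) := by
        have h2 := E.higgs_residue i c z hi.symm
        exact tendsto_pi_nhds.1 (tendsto_pi_nhds.1 h2 k) l
      have h4 := h1.sub (tendsto_mul_sum_poleFun hx hi.symm fun i => E.res i k l)
      simpa [mul_sub] using h4
  choose H hH hH' using key
  have hev : ∀ w, w ≠ 0 → chartPt true w ∉ Set.range x →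
      H false w⁻¹ = -w ^ 2 * H true w - w * ∑ i, E.res i k l := by
    intro w hw hwx
    have hwx' : chartPt false w⁻¹ ∉ Set.range x := by rwa [← chartPt_true_of_ne hw]
    rw [hH' true w hwx, hH' false w⁻¹ hwx', sum_poleFun_transition hw hwx,
      E.higgs_transition w hw hwx]
    simp only [Matrix.smul_apply, smul_eq_mul]
    field_simp
    ring
  have hev' : ∀ᶠ w in 𝓝[≠] 0, H false w⁻¹ = -w ^ 2 * H true w - w * ∑ i, E.res i k l := by
    filter_upwards [eventually_notMem_range x true 0, self_mem_nhdsWithin] with w hw hw'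
    exact hev w hw' hw
  have hHt : Continuous (H true) := (hH true).continuous
  have h0 : ∀ z, H false z = 0 := by
    intro z
    have h1 := eq_of_eventually_inv (hH false) (u := fun w => -w ^ 2 * H true w -
      w * ∑ i, E.res i k l) (by fun_prop) hev' z
    simpa using h1
  have hsum : ∑ i, E.res i k l = 0 := by
    have h1 : Filter.Tendsto (fun w => -(w * H true w)) (𝓝[≠] 0) (𝓝 (∑ i, E.res i k l)) := by
      refine tendsto_const_nhds.congr' ?_
      filter_upwards [hev', self_mem_nhdsWithin] with w hw hw'
      rw [h0] at hw
      have hw'' : w ≠ 0 := hw'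
      apply mul_left_cancel₀ hw''
      linear_combination hw
    have h2 : Filter.Tendsto (fun w => -(w * H true w)) (𝓝[≠] 0) (𝓝 0) := by
      have : ContinuousAt (fun w => -(w * H true w)) 0 := by fun_prop
      simpa using this.tendsto.mono_left nhdsWithin_le_nhds
    exact tendsto_nhds_unique h1 h2
  have h1 : ∀ᶠ w in 𝓝[≠] 0, H true w = 0 := by
    filter_upwards [hev', self_mem_nhdsWithin] with w hw hw'
    rw [h0, hsum] at hw
    have hw'' : w ≠ 0 := hw'
    have h2 : w ^ 2 * H true w = 0 := by linear_combination hw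
    exact (mul_eq_zero.1 h2).resolve_left (pow_ne_zero 2 hw'')
  have h1' : H true 0 = 0 := by
    have h3 := hHt.continuousAt.tendsto.mono_left (nhdsWithin_le_nhds (s := {0}ᶜ) (a := (0 : ℂ)))
    exact tendsto_nhds_unique h3 (tendsto_const_nhds.congr' (h1.mono fun _ h => h.symm))
  refine ⟨hsum, fun c ζ hζ => ?_⟩
  rw [← sub_eq_zero, ← hH' c ζ hζ]
  cases c
  · exact h0 ζ
  · by_cases hz : ζ = 0
    · rw [hz, h1']
    · have h2 := hev ζ hz hζ
      rw [h0, hsum] at h2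
      have h3 : ζ ^ 2 * H true ζ = 0 := by linear_combination h2
      exact (mul_eq_zero.1 h3).resolve_left (pow_ne_zero 2 hz)

/-- The residue theorem. -/
theorem Higgs.sum_res (hx : Function.Injective x) (E : Higgs x) : ∑ i, E.res i = 0 := by
  ext k l
  rw [Matrix.sum_apply]
  exact (E.entry_eq hx k l).1

/-- The Higgs field is determined by its residues. -/
theorem Higgs.higgs_eq (hx : Function.Injective x) (E : Higgs x) {c : Bool} {ζ : ℂ}
    (h : chartPt c ζ ∉ Set.range x) : E.higgs c ζ = ∑ i, poleFun c (x i) ζ • E.res i := by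
  ext k l
  rw [(E.entry_eq hx k l).2 c ζ h, Matrix.sum_apply]
  rfl

/-- The flag lies in the kernel, which is a proper subspace of `ℂ²`, so the dimensions agree. Flags
are thus redundant data for stable bundles. -/
theorem mem_flag_iff {E : Higgs x} {i : Fin n} (h : E.res i ≠ 0) {v : Fin 2 → ℂ} :
    v ∈ E.flag i ↔ E.res i *ᵥ v = 0 := by
  have h1 : E.flag i ≤ LinearMap.ker (E.res i).mulVecLin := fun v hv =>
    E.res_flag_eq_zero i v hv
  have h2 : LinearMap.ker (E.res i).mulVecLin ≠ ⊤ := fun h0 => h (by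
    rw [LinearMap.ker_eq_top] at h0
    exact Matrix.toLin'.map_eq_zero_iff.1 h0)
  have h3 := Submodule.finrank_lt h2
  rw [Submodule.eq_of_le_of_finrank_le h1 (by
    rw [E.finrank_flag]
    simp only [Module.finrank_fin_fun] at h3
    omega)]
  rfl

theorem Higgs.res_mul_self (E : Higgs x) (i : Fin n) : E.res i * E.res i = 0 := by
  refine Matrix.ext_of_mulVec_single fun k => ?_
  rw [← Matrix.mulVec_mulVec, E.res_flag_eq_zero i _ (E.res_mem_flag i _), Matrix.zero_mulVec]

theorem Higgs.res_trace (E : Higgs x) (i : Fin n) : (E.res i).trace = 0 := by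
  have h : IsNilpotent (E.res i) := ⟨2, by rw [pow_two, E.res_mul_self]⟩
  exact (Matrix.isNilpotent_trace_of_isNilpotent h).eq_zero

/-! ### Isomorphism and stability in terms of residues -/

/-- Isomorphisms of Higgs bundles conjugate the residues by a constant matrix. -/
theorem IsIso.exists_conj {E E' : Higgs x} {g : CP1 → Matrix (Fin 2) (Fin 2) ℂ}
    (h : IsIso E E' g) : ∃ G : Matrix (Fin 2) (Fin 2) ℂ, G.det ≠ 0 ∧
      ∀ i, E'.res i * G = G * E.res i := by
  have hg : ∀ p, g p = g (chartPt true 0) := fun p => by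
    ext k l
    exact eq_of_holomorphic (f := fun p => g p k l) (fun c => h.holomorphic c k l) p
  refine ⟨g (chartPt true 0), h.det_ne_zero _, fun i => ?_⟩
  obtain ⟨c, ζ, hζ⟩ := exists_chartPt (x i)
  have h1 := (E'.higgs_residue i c ζ hζ).mul_const (g (chartPt true 0))
  have h2 := (E.higgs_residue i c ζ hζ).const_mul (g (chartPt true 0))
  refine tendsto_nhds_unique h1 (h2.congr' ?_)
  filter_upwards [eventually_notMem_range x c ζ] with u hu
  have h3 := h.higgs_comm c u hu
  rw [hg (chartPt c u)] at h3
  rw [Matrix.mul_smul, Matrix.smul_mul, h3]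

/-- Nothing besides the residues has to be matched: the flags are their kernels and the Higgs field
is a combination of them. -/
theorem isIso_const (hx : Function.Injective x) {E E' : Higgs x} (hE : ∀ i, E.res i ≠ 0)
    (hE' : ∀ i, E'.res i ≠ 0) {G : Matrix (Fin 2) (Fin 2) ℂ} (hG : G.det ≠ 0)
    (h : ∀ i, E'.res i * G = G * E.res i) : IsIso E E' (fun _ => G) where
  det_ne_zero _ := hG
  holomorphic _ _ _ := differentiable_const _
  flag_eq i := by
    ext v
    rw [mem_flag_iff (hE' i), Submodule.mem_map]
    constructor
    · intro hv
      have h1 : G *ᵥ (G⁻¹ *ᵥ v) = v := by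
        rw [Matrix.mulVec_mulVec, Matrix.mul_nonsing_inv _ hG.isUnit, Matrix.one_mulVec]
      refine ⟨G⁻¹ *ᵥ v, (mem_flag_iff (hE i)).2 ?_, h1⟩
      have h2 : G *ᵥ (E.res i *ᵥ (G⁻¹ *ᵥ v)) = 0 := by
        rw [Matrix.mulVec_mulVec, ← h, ← Matrix.mulVec_mulVec, h1, hv]
      have h3 := congrArg (G⁻¹ *ᵥ ·) h2
      rwa [Matrix.mulVec_mulVec, Matrix.nonsing_inv_mul _ hG.isUnit, Matrix.one_mulVec,
        Matrix.mulVec_zero] at h3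
    · rintro ⟨w, hw, rfl⟩
      rw [mem_flag_iff (hE i)] at hw
      rw [Matrix.mulVecLin_apply, Matrix.mulVec_mulVec, h, ← Matrix.mulVec_mulVec, hw,
        Matrix.mulVec_zero]
  higgs_comm c ζ hζ := by
    simp only [E.higgs_eq hx hζ, E'.higgs_eq hx hζ, Finset.sum_mul, Finset.mul_sum,
      Matrix.smul_mul, Matrix.mul_smul, h]

theorem mk_eq_mk_iff (hx : Function.Injective x) {E E' : Stable x} :
    Moduli.mk E = Moduli.mk E' ↔ ∃ G : Matrix (Fin 2) (Fin 2) ℂ, G.det ≠ 0 ∧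
      ∀ i, E'.1.res i * G = G * E.1.res i := by
  constructor
  · intro h
    obtain ⟨g, hg⟩ : ∃ g, IsIso E.1 E'.1 g := Quotient.exact h
    exact hg.exists_conj
  · rintro ⟨G, hG, h⟩
    exact Quotient.sound ⟨_, isIso_const hx E.2.1 E'.2.1 hG h⟩

/-- If all flags coincide, that constant line is invariant and its slope `n / 2` equals that of `E`.
Otherwise a subbundle of degree at most `-1` has slope at most `n / 2 - 1`, and one of degree 0 is
constant and misses some flag. -/
theorem isStable_iff (hx : Function.Injective x) (E : Higgs x) :
    IsStable E ↔ (∀ i, E.res i ≠ 0) ∧ ∃ i j, E.flag i ≠ E.flag j := by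
  have hslope : ∀ (d : ℤ) (k : ℕ), parSlope d k 1 < parSlope 0 n 2 ↔ (d : ℚ) + k / 2 < n / 2 := by
    intro d k
    simp only [parSlope]
    push_cast
    constructor <;> intro h <;> linarith
  constructor
  · rintro ⟨h0, h⟩
    refine ⟨h0, ?_⟩
    by_contra! hall
    obtain ⟨v, hv, hvf⟩ : ∃ v, v ≠ 0 ∧ ∀ i, E.flag i = Submodule.span ℂ {v} := by
      rcases isEmpty_or_nonempty (Fin n) with hn | ⟨⟨i⟩⟩
      -- Without marked points there is no flag to copy, and any nonzero vector serves.
      · exact ⟨1, one_ne_zero, fun i => hn.elim i⟩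
      · obtain ⟨v, hv, hvi⟩ := exists_span_of_finrank (E.finrank_flag i)
        exact ⟨v, hv, fun j => (hall j i).trans hvi⟩
    have h1 := h (fun _ => Submodule.span ℂ {v}) 0 Finset.univ (isLineSubbundle_const hv)
      (fun i _ => (hvf i).symm) (fun c ζ hζ w hw => by
        rw [E.higgs_eq hx hζ, Matrix.sum_mulVec]
        refine Submodule.sum_mem _ fun i _ => ?_
        rw [Matrix.smul_mulVec, ← hvf i]
        exact Submodule.smul_mem _ _ (E.res_mem_flag i w))
    rw [hslope] at h1
    simp at h1
  · rintro ⟨h0, i, j, hij⟩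
    refine ⟨h0, fun L d D' hL hD _ => ?_⟩
    rw [hslope]
    have hcard : D'.card ≤ n := by simpa using D'.card_le_univ
    rcases hL.degree_nonpos.lt_or_eq with hd | rfl
    · have h1 : (d : ℚ) ≤ -1 := by exact_mod_cast Int.le_sub_one_of_lt hd
      have h2 : (D'.card : ℚ) ≤ n := by exact_mod_cast hcard
      linarith
    · obtain ⟨v, -, hv⟩ := hL.exists_eq_span
      have h1 : D'.card ≠ n := fun h1 => by
        have h2 : D' = Finset.univ := by
          rw [← Finset.card_eq_iff_eq_univ]; simpa using h1
        refine hij ?_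
        rw [← hD i (by simp [h2]), ← hD j (by simp [h2]), hv, hv]
      have h2 : (D'.card : ℚ) < n := by exact_mod_cast lt_of_le_of_ne hcard h1
      push_cast
      linarith

theorem finrank_ker_of_mul_self {A : Matrix (Fin 2) (Fin 2) ℂ} (h0 : A ≠ 0) (h2 : A * A = 0) :
    Module.finrank ℂ (LinearMap.ker A.mulVecLin) = 1 := by
  have h3 := LinearMap.finrank_range_add_finrank_ker A.mulVecLin
  have h4 : LinearMap.range A.mulVecLin ≤ LinearMap.ker A.mulVecLin := by
    rintro _ ⟨v, rfl⟩
    rw [LinearMap.mem_ker, Matrix.mulVecLin_apply, Matrix.mulVecLin_apply, Matrix.mulVec_mulVec, h2,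
      Matrix.zero_mulVec]
  have h5 := Submodule.finrank_mono h4
  have h6 : Module.finrank ℂ (LinearMap.range A.mulVecLin) ≠ 0 := fun h => by
    rw [Submodule.finrank_eq_zero, LinearMap.range_eq_bot] at h
    exact h0 (Matrix.toLin'.map_eq_zero_iff.1 h)
  rw [Module.finrank_fin_fun] at h3
  omega

/-- The Higgs bundle with given residues. -/
noncomputable def Higgs.ofResidues (hx : Function.Injective x)
    (A : Fin n → Matrix (Fin 2) (Fin 2) ℂ) (h0 : ∀ i, A i ≠ 0) (h2 : ∀ i, A i * A i = 0)
    (hs : ∑ i, A i = 0) : Higgs x where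
  flag i := LinearMap.ker (A i).mulVecLin
  finrank_flag i := finrank_ker_of_mul_self (h0 i) (h2 i)
  higgs c u := ∑ i, poleFun c (x i) u • A i
  higgs_transition w hw hwx := by
    ext k l
    have h1 := sum_poleFun_transition hw hwx fun i => A i k l
    have h3 : ∑ i, A i k l = 0 := by rw [← Matrix.sum_apply, hs]; rfl
    simpa [Matrix.sum_apply, h3] using h1
  higgs_holomorphic c ζ hζ k l := by
    simp only [Matrix.sum_apply, Matrix.smul_apply, smul_eq_mul]
    refine DifferentiableAt.fun_sum fun i _ => ?_
    exact (poleFun_differentiableAt fun h => hζ ⟨i, h.symm⟩).mul_const _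
  higgs_trace c ζ _ := by
    have h3 : ∀ i, (A i).trace = 0 := fun i =>
      (Matrix.isNilpotent_trace_of_isNilpotent ⟨2, by rw [pow_two, h2]⟩).eq_zero
    simp [Matrix.trace_sum, Matrix.trace_smul, h3]
  res := A
  higgs_residue i c ζ hζ := by
    refine tendsto_pi_nhds.2 fun k => tendsto_pi_nhds.2 fun l => ?_
    simpa [Matrix.sum_apply] using tendsto_mul_sum_poleFun hx hζ fun i => A i k l
  res_mem_flag i v := by
    rw [LinearMap.mem_ker, Matrix.mulVecLin_apply, Matrix.mulVec_mulVec, h2, Matrix.zero_mulVec]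
  res_flag_eq_zero i v hv := hv

/-- The image of `A j` lies in the `j`-th flag. If that were also the `i`-th flag, the kernel of `A
i`, then `A i * A j` would vanish. -/
theorem isStable_ofResidues (hx : Function.Injective x)
    {A : Fin n → Matrix (Fin 2) (Fin 2) ℂ} (h0 : ∀ i, A i ≠ 0) (h2 : ∀ i, A i * A i = 0)
    (hs : ∑ i, A i = 0) {i j : Fin n} (hij : A i * A j ≠ 0) :
    IsStable (Higgs.ofResidues hx A h0 h2 hs) := by
  refine (isStable_iff hx _).2 ⟨h0, i, j, fun h => hij ?_⟩
  refine Matrix.ext_of_mulVec_single fun k => ?_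
  have h1 : A j *ᵥ Pi.single k 1 ∈ (Higgs.ofResidues hx A h0 h2 hs).flag j :=
    Higgs.res_mem_flag _ j _
  rw [← h] at h1
  rw [← Matrix.mulVec_mulVec, Matrix.zero_mulVec]
  exact h1

/-! ### Pairs of lines and the off-diagonal normal form -/

theorem isCompl_of_finrank_eq_one {l l' : Submodule ℂ (Fin 2 → ℂ)}
    (h : Module.finrank ℂ l = 1) (h' : Module.finrank ℂ l' = 1) (hne : l ≠ l') : IsCompl l l' := by
  have h1 : l ⊓ l' = ⊥ := by
    rw [← Submodule.finrank_eq_zero (R := ℂ)]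
    by_contra h0
    have h2 := Submodule.finrank_mono (inf_le_left : l ⊓ l' ≤ l)
    have h3 : l ⊓ l' = l := Submodule.eq_of_le_of_finrank_eq inf_le_left (by omega)
    exact hne (Submodule.eq_of_le_of_finrank_eq (inf_eq_left.1 h3) (by omega))
  refine ⟨disjoint_iff.2 h1, codisjoint_iff.2 ?_⟩
  have h2 := Submodule.finrank_sup_add_finrank_inf_eq l l'
  rw [h1, finrank_bot, h, h'] at h2
  refine Submodule.eq_top_of_finrank_eq ?_
  rw [Module.finrank_fin_fun]
  omega

theorem eq_span_of_mem {l : Submodule ℂ (Fin 2 → ℂ)} (h : Module.finrank ℂ l = 1)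
    {v : Fin 2 → ℂ} (hv : v ≠ 0) (hvl : v ∈ l) : l = Submodule.span ℂ {v} :=
  (Submodule.eq_of_le_of_finrank_eq ((Submodule.span_singleton_le_iff_mem _ _).2 hvl)
    (by rw [finrank_span_singleton hv, h])).symm

theorem span_ne_span_of_det {G : Matrix (Fin 2) (Fin 2) ℂ} (hG : G.det ≠ 0) :
    Submodule.span ℂ {G.col 0} ≠ Submodule.span ℂ {G.col 1} := by
  intro h
  have h1 := Submodule.mem_span_singleton_self (R := ℂ) (G.col 0)
  rw [h, Submodule.mem_span_singleton] at h1
  obtain ⟨t, ht⟩ := h1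
  have h2 := congrFun ht 0
  have h3 := congrFun ht 1
  simp only [Pi.smul_apply, Matrix.col_apply, smul_eq_mul] at h2 h3
  rw [Matrix.det_fin_two, ← h2, ← h3] at hG
  exact hG (by ring)

theorem col_ne_zero_of_det {G : Matrix (Fin 2) (Fin 2) ℂ} (hG : G.det ≠ 0) (k : Fin 2) :
    G.col k ≠ 0 := by
  intro h
  have h0 : ∀ l, G l k = 0 := fun l => congrFun h l
  exact hG (Matrix.det_eq_zero_of_column_eq_zero k h0)

theorem det_ne_zero_of_span_ne {G : Matrix (Fin 2) (Fin 2) ℂ} (h0 : G.col 0 ≠ 0)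
    (h1 : G.col 1 ≠ 0) (h : Submodule.span ℂ {G.col 0} ≠ Submodule.span ℂ {G.col 1}) :
    G.det ≠ 0 := by
  intro hdet
  apply h
  have hf : Module.finrank ℂ (Submodule.span ℂ {G.col 0}) = 1 := finrank_span_singleton h0
  refine eq_span_of_mem hf h1 ?_
  -- The determinant is, up to sign, the pairing of the second column with the rotated first one, so
  -- its vanishing puts the second column in the double annihilator of the first.
  rw [← annihilator_annihilator hf, annihilator_span h0, mem_annihilator]
  intro w hw
  obtain ⟨t, rfl⟩ := Submodule.mem_span_singleton.1 hw
  rw [Matrix.det_fin_two] at hdet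
  rw [rot_apply]
  simp only [dotProduct, Fin.sum_univ_two, Pi.smul_apply, Matrix.cons_val_zero, Matrix.col_apply,
    Matrix.cons_val_one, smul_eq_mul]
  linear_combination t * hdet

/-- The residues of the Higgs field of a quasi-parabolic `SL(2, ℝ)`-Higgs bundle of type `S`, with
respect to the decomposition `E = L₀ ⊕ L₁`. -/
noncomputable def offDiag (S : Finset (Fin n)) (a : Fin n → ℂ) (i : Fin n) :
    Matrix (Fin 2) (Fin 2) ℂ :=
  if i ∈ S then !![0, a i; 0, 0] else !![0, 0; a i, 0]

theorem offDiag_mul_self (S : Finset (Fin n)) (a : Fin n → ℂ) (i : Fin n) :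
    offDiag S a i * offDiag S a i = 0 := by
  unfold offDiag
  split_ifs <;> ext k l <;> fin_cases k <;> fin_cases l <;> simp

theorem offDiag_eq_zero_iff {S : Finset (Fin n)} {a : Fin n → ℂ} {i : Fin n} :
    offDiag S a i = 0 ↔ a i = 0 := by
  constructor
  · intro h
    unfold offDiag at h
    split_ifs at h
    · simpa using congrFun (congrFun h 0) 1
    · simpa using congrFun (congrFun h 1) 0
  · intro h
    unfold offDiag
    split_ifs <;> ext k l <;> fin_cases k <;> fin_cases l <;> simp [h]

theorem sum_offDiag_eq_zero_iff {S : Finset (Fin n)} {a : Fin n → ℂ} :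
    ∑ i, offDiag S a i = 0 ↔ ∑ i ∈ S, a i = 0 ∧ ∑ i ∈ Sᶜ, a i = 0 := by
  have h : ∑ i, offDiag S a i = !![0, ∑ i ∈ S, a i; ∑ i ∈ Sᶜ, a i, 0] := by
    have h01 : ∀ i, offDiag S a i 0 1 = if i ∈ S then a i else 0 := fun i => by
      unfold offDiag; split_ifs <;> rfl
    have h10 : ∀ i, offDiag S a i 1 0 = if i ∈ Sᶜ then a i else 0 := fun i => by
      unfold offDiag; by_cases hi : i ∈ S <;> simp [hi]
    have h00 : ∀ i, offDiag S a i 0 0 = 0 := fun i => by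
      unfold offDiag; split_ifs <;> rfl
    have h11 : ∀ i, offDiag S a i 1 1 = 0 := fun i => by
      unfold offDiag; split_ifs <;> rfl
    ext k l
    rw [Matrix.sum_apply]
    fin_cases k <;> fin_cases l
    · simpa using Finset.sum_eq_zero fun i _ => h00 i
    · simp only [Fin.zero_eta, Fin.mk_one, h01, Finset.sum_ite_mem, Finset.univ_inter]; rfl
    · simp only [Fin.zero_eta, Fin.mk_one, h10, Finset.sum_ite_mem, Finset.univ_inter]; rfl
    · simpa using Finset.sum_eq_zero fun i _ => h11 i
  rw [h]
  constructor
  · intro h1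
    exact ⟨by simpa using congrFun (congrFun h1 0) 1, by simpa using congrFun (congrFun h1 1) 0⟩
  · rintro ⟨h1, h2⟩
    rw [h1, h2]
    ext k l
    fin_cases k <;> fin_cases l <;> rfl

theorem mul_eq_mul_offDiag_iff_of_mem {S : Finset (Fin n)} {a : Fin n → ℂ} {i : Fin n}
    (hi : i ∈ S) {A G : Matrix (Fin 2) (Fin 2) ℂ} :
    A * G = G * offDiag S a i ↔ A *ᵥ G.col 0 = 0 ∧ A *ᵥ G.col 1 = a i • G.col 0 := by
  simp only [offDiag, if_pos hi, ← Matrix.ext_iff, funext_iff, Fin.forall_fin_two, Matrix.mul_apply,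
    Matrix.mulVec, dotProduct, Fin.sum_univ_two, Matrix.col_apply, Pi.smul_apply, Pi.zero_apply,
    smul_eq_mul, Matrix.of_apply, Matrix.cons_val_zero, Matrix.cons_val_one]
  simp only [mul_zero, add_zero, mul_comm (a i)]
  tauto

theorem mul_eq_mul_offDiag_iff_of_notMem {S : Finset (Fin n)} {a : Fin n → ℂ} {i : Fin n}
    (hi : i ∉ S) {A G : Matrix (Fin 2) (Fin 2) ℂ} :
    A * G = G * offDiag S a i ↔ A *ᵥ G.col 0 = a i • G.col 1 ∧ A *ᵥ G.col 1 = 0 := by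
  simp only [offDiag, if_neg hi, ← Matrix.ext_iff, funext_iff, Fin.forall_fin_two, Matrix.mul_apply,
    Matrix.mulVec, dotProduct, Fin.sum_univ_two, Matrix.col_apply, Pi.smul_apply, Pi.zero_apply,
    smul_eq_mul, Matrix.of_apply, Matrix.cons_val_zero, Matrix.cons_val_one]
  simp only [mul_zero, zero_add, add_zero, mul_comm (a i)]
  tauto

/-- The frame given by the columns of `G` puts the residues of `E` into the normal form
`offDiag S a`. -/
def IsNormalForm (E : Higgs x) (S : Finset (Fin n)) (G : Matrix (Fin 2) (Fin 2) ℂ)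
    (a : Fin n → ℂ) : Prop :=
  G.det ≠ 0 ∧ ∀ i, E.res i * G = G * offDiag S a i

/-- A residue maps everything into its flag and kills the flag; when the flag is spanned by a frame
vector, a single off-diagonal entry survives. -/
theorem exists_isNormalForm_of_flag {E : Higgs x} {S : Finset (Fin n)}
    {G : Matrix (Fin 2) (Fin 2) ℂ} (hG : G.det ≠ 0)
    (h0 : ∀ i ∈ S, E.flag i = Submodule.span ℂ {G.col 0})
    (h1 : ∀ i ∉ S, E.flag i = Submodule.span ℂ {G.col 1}) :
    ∃ a, IsNormalForm E S G a := by
  -- `offDiag` at `i` reads only the `i`-th coefficient, so constant families suffice here and glue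
  -- afterwards.
  have key : ∀ i, ∃ a : ℂ, E.res i * G = G * offDiag S (fun _ => a) i := by
    intro i
    by_cases hi : i ∈ S
    · have h2 := E.res_mem_flag i (G.col 1)
      rw [h0 i hi] at h2
      obtain ⟨a, ha⟩ := Submodule.mem_span_singleton.1 h2
      refine ⟨a, (mul_eq_mul_offDiag_iff_of_mem hi).2 ⟨E.res_flag_eq_zero i _ ?_, ha.symm⟩⟩
      rw [h0 i hi]
      exact Submodule.mem_span_singleton_self _
    · have h2 := E.res_mem_flag i (G.col 0)
      rw [h1 i hi] at h2
      obtain ⟨a, ha⟩ := Submodule.mem_span_singleton.1 h2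
      refine ⟨a, (mul_eq_mul_offDiag_iff_of_notMem hi).2 ⟨ha.symm, E.res_flag_eq_zero i _ ?_⟩⟩
      rw [h1 i hi]
      exact Submodule.mem_span_singleton_self _
  choose a ha using key
  exact ⟨a, hG, ha⟩

theorem IsNormalForm.mulVec_col_zero {E : Higgs x} {S : Finset (Fin n)}
    {G : Matrix (Fin 2) (Fin 2) ℂ} {a : Fin n → ℂ} (h : IsNormalForm E S G a) (i : Fin n) :
    E.res i *ᵥ G.col 0 = if i ∈ S then 0 else a i • G.col 1 := by
  split_ifs with hi
  · exact ((mul_eq_mul_offDiag_iff_of_mem hi).1 (h.2 i)).1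
  · exact ((mul_eq_mul_offDiag_iff_of_notMem hi).1 (h.2 i)).1

theorem IsNormalForm.mulVec_col_one {E : Higgs x} {S : Finset (Fin n)}
    {G : Matrix (Fin 2) (Fin 2) ℂ} {a : Fin n → ℂ} (h : IsNormalForm E S G a) (i : Fin n) :
    E.res i *ᵥ G.col 1 = if i ∈ S then a i • G.col 0 else 0 := by
  split_ifs with hi
  · exact ((mul_eq_mul_offDiag_iff_of_mem hi).1 (h.2 i)).2
  · exact ((mul_eq_mul_offDiag_iff_of_notMem hi).1 (h.2 i)).2

theorem IsNormalForm.flag_eq {E : Higgs x} (hE : ∀ i, E.res i ≠ 0) {S : Finset (Fin n)}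
    {G : Matrix (Fin 2) (Fin 2) ℂ} {a : Fin n → ℂ} (h : IsNormalForm E S G a) (i : Fin n) :
    E.flag i = if i ∈ S then Submodule.span ℂ {G.col 0} else Submodule.span ℂ {G.col 1} := by
  split_ifs with hi
  · refine eq_span_of_mem (E.finrank_flag i) (col_ne_zero_of_det h.1 0) ?_
    rw [mem_flag_iff (hE i), h.mulVec_col_zero, if_pos hi]
  · refine eq_span_of_mem (E.finrank_flag i) (col_ne_zero_of_det h.1 1) ?_
    rw [mem_flag_iff (hE i), h.mulVec_col_one, if_neg hi]

theorem IsNormalForm.ne_zero {E : Higgs x} (hE : ∀ i, E.res i ≠ 0) {S : Finset (Fin n)}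
    {G : Matrix (Fin 2) (Fin 2) ℂ} {a : Fin n → ℂ} (h : IsNormalForm E S G a) (i : Fin n) :
    a i ≠ 0 := by
  intro h0
  have h1 := h.2 i
  rw [offDiag_eq_zero_iff.2 h0, mul_zero] at h1
  apply hE i
  rw [← Matrix.mul_nonsing_inv_cancel_right G (E.res i) h.1.isUnit, h1, zero_mul]

theorem IsNormalForm.sum_eq_zero (hx : Function.Injective x) {E : Higgs x} {S : Finset (Fin n)}
    {G : Matrix (Fin 2) (Fin 2) ℂ} {a : Fin n → ℂ} (h : IsNormalForm E S G a) :
    ∑ i ∈ S, a i = 0 ∧ ∑ i ∈ Sᶜ, a i = 0 := by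
  rw [← sum_offDiag_eq_zero_iff, ← Matrix.nonsing_inv_mul_cancel_left G (∑ i, offDiag S a i)
    h.1.isUnit, Finset.mul_sum]
  simp_rw [← h.2]
  rw [← Finset.sum_mul, E.sum_res hx, zero_mul, mul_zero]

/-- Degree-0 subbundles are constant, so `L₀` and `L₁` are two lines in `ℂ²` and give a frame. The
flag conditions alone then force the normal form; the conditions on the Higgs field follow from it.
-/
theorem isRealType_iff (hx : Function.Injective x) {S : Finset (Fin n)} {E : Higgs x}
    (hE : ∀ i, E.res i ≠ 0) : IsRealType S E ↔ ∃ G a, IsNormalForm E S G a := by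
  constructor
  · rintro ⟨L₀, L₁, h0, h1, hc, hf0, hf1, -⟩
    obtain ⟨v, hv, hL0⟩ := h0.exists_eq_span
    obtain ⟨w, hw, hL1⟩ := h1.exists_eq_span
    set G : Matrix (Fin 2) (Fin 2) ℂ := Matrix.of fun k l => if l = 0 then v k else w k with hG
    have hG0 : G.col 0 = v := by ext k; simp [hG]
    have hG1 : G.col 1 = w := by ext k; simp [hG]
    refine ⟨G, exists_isNormalForm_of_flag (det_ne_zero_of_span_ne ?_ ?_ ?_)
      (fun i hi => ?_) (fun i hi => ?_)⟩
    · rwa [hG0]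
    · rwa [hG1]
    · have h2 := hc (OnePoint.infty)
      rw [hL0, hL1] at h2
      rw [hG0, hG1]
      intro h3
      rw [h3, isCompl_iff, disjoint_self, Submodule.span_singleton_eq_bot] at h2
      exact hw h2.1
    · rw [hf0 i hi, hL0, hG0]
    · rw [hf1 i hi, hL1, hG1]
  · rintro ⟨G, a, h⟩
    have hc0 := col_ne_zero_of_det h.1 0
    have hc1 := col_ne_zero_of_det h.1 1
    have hmem0 := Submodule.mem_span_singleton_self (R := ℂ) (G.col 0)
    have hmem1 := Submodule.mem_span_singleton_self (R := ℂ) (G.col 1)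
    have h0 : ∀ i, ∀ v ∈ Submodule.span ℂ {G.col 0},
        E.res i *ᵥ v ∈ Submodule.span ℂ {G.col 1} := by
      intro i v hv
      obtain ⟨t, rfl⟩ := Submodule.mem_span_singleton.1 hv
      rw [Matrix.mulVec_smul, h.mulVec_col_zero]
      split_ifs
      · simp
      · exact Submodule.smul_mem _ _ (Submodule.smul_mem _ _ hmem1)
    have h1 : ∀ i, ∀ v ∈ Submodule.span ℂ {G.col 1},
        E.res i *ᵥ v ∈ Submodule.span ℂ {G.col 0} := by
      intro i v hv
      obtain ⟨t, rfl⟩ := Submodule.mem_span_singleton.1 hv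
      rw [Matrix.mulVec_smul, h.mulVec_col_one]
      split_ifs
      · exact Submodule.smul_mem _ _ (Submodule.smul_mem _ _ hmem0)
      · simp
    have hf0 : ∀ i ∈ S, E.flag i = Submodule.span ℂ {G.col 0} := fun i hi => by
      rw [h.flag_eq hE, if_pos hi]
    have hf1 : ∀ i ∉ S, E.flag i = Submodule.span ℂ {G.col 1} := fun i hi => by
      rw [h.flag_eq hE, if_neg hi]
    refine ⟨fun _ => Submodule.span ℂ {G.col 0}, fun _ => Submodule.span ℂ {G.col 1},
      isLineSubbundle_const hc0, isLineSubbundle_const hc1, fun _ =>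
      isCompl_of_finrank_eq_one (finrank_span_singleton hc0) (finrank_span_singleton hc1)
        (span_ne_span_of_det h.1), hf0, hf1, fun c ζ hζ => ⟨fun v hv => ?_, fun v hv => ?_⟩,
      fun i hi => ⟨h1 i, fun v hv => E.res_flag_eq_zero i v ?_⟩,
      fun i hi => ⟨h0 i, fun v hv => E.res_flag_eq_zero i v ?_⟩⟩
    · rw [E.higgs_eq hx hζ, Matrix.sum_mulVec]
      refine Submodule.sum_mem _ fun i _ => ?_
      rw [Matrix.smul_mulVec]
      exact Submodule.smul_mem _ _ (h0 i v hv)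
    · rw [E.higgs_eq hx hζ, Matrix.sum_mulVec]
      refine Submodule.sum_mem _ fun i _ => ?_
      rw [Matrix.smul_mulVec]
      exact Submodule.smul_mem _ _ (h1 i v hv)
    · rwa [hf0 i hi]
    · rwa [hf1 i hi]

theorem mk_mem_ZSet_iff (hx : Function.Injective x) {S : Finset (Fin n)} {E : Stable x} :
    Moduli.mk E ∈ ZSet x S ↔ ∃ G a, IsNormalForm E.1 S G a := by
  constructor
  · rintro ⟨E', h, hE'⟩
    obtain ⟨G, a, hG, hGa⟩ := (isRealType_iff hx E'.2.1).1 hE'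
    obtain ⟨H, hH, hHE⟩ := (mk_eq_mk_iff hx).1 h
    refine ⟨H * G, a, by rw [Matrix.det_mul]; exact mul_ne_zero hH hG, fun i => ?_⟩
    rw [← Matrix.mul_assoc, hHE, Matrix.mul_assoc, hGa, Matrix.mul_assoc]
  · exact fun h => ⟨E, rfl, (isRealType_iff hx E.2.1).2 h⟩

/-! ### Fixed points of the involution -/

theorem theta_mk_eq_iff (hx : Function.Injective x) {E : Stable x} :
    Theta (Moduli.mk E) = Moduli.mk E ↔ ∃ G : Matrix (Fin 2) (Fin 2) ℂ, G.det ≠ 0 ∧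
      ∀ i, E.1.res i * G = G * (E.1.res i)ᵀ :=
  mk_eq_mk_iff hx (E := ⟨E.1.dual, E.2.dual⟩) (E' := E)

theorem IsNormalForm.theta_eq (hx : Function.Injective x) {E : Stable x} {S : Finset (Fin n)}
    {G : Matrix (Fin 2) (Fin 2) ℂ} {a : Fin n → ℂ} (h : IsNormalForm E.1 S G a) :
    Theta (Moduli.mk E) = Moduli.mk E := by
  have hP : ∀ i, offDiag S a i * !![0, 1; 1, 0] = !![0, 1; 1, 0] * (offDiag S a i)ᵀ := by
    intro i
    unfold offDiag
    split_ifs <;> ext k l <;> fin_cases k <;> fin_cases l <;>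
      simp [Matrix.vecMul, dotProduct, Fin.sum_univ_two]
  -- The swap intertwines each normal form with its transpose; `G` on the left and `Gᵀ` on the right
  -- carry this back to the given frame.
  refine (theta_mk_eq_iff hx).2 ⟨G * !![0, 1; 1, 0] * Gᵀ, ?_, fun i => ?_⟩
  · simp [Matrix.det_fin_two_of, h.1]
  · rw [← Matrix.mul_assoc, ← Matrix.mul_assoc, h.2, Matrix.mul_assoc G, hP, Matrix.mul_assoc,
      Matrix.mul_assoc, ← Matrix.transpose_mul, ← h.2, Matrix.transpose_mul]
    simp only [Matrix.mul_assoc]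

theorem exists_flag_ne (hx : Function.Injective x) (E : Stable x) (i : Fin n) :
    ∃ j, E.1.flag j ≠ E.1.flag i := by
  obtain ⟨-, j, k, hjk⟩ := (isStable_iff hx E.1).1 E.2
  by_contra! h
  exact hjk ((h j).trans (h k).symm)

/-- If a matrix anticommutes with all residues, the flags are among two lines. -/
theorem flag_eq_or_of_anticomm {E : Higgs x} (hE : ∀ i, E.res i ≠ 0)
    {H : Matrix (Fin 2) (Fin 2) ℂ} (hdet : H.det ≠ 0)
    (hH : ∀ i, E.res i * H = -(H * E.res i)) {i₀ k : Fin n} (hk : E.flag k ≠ E.flag i₀)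
    (i : Fin n) : E.flag i = E.flag i₀ ∨ E.flag i = E.flag k := by
  -- Anticommutation makes `H` preserve the kernel of each residue, so every flag is an eigenline of
  -- `H`.
  have key : ∀ i, ∃ v : Fin 2 → ℂ, ∃ t : ℂ, v ≠ 0 ∧ t ≠ 0 ∧ E.flag i = Submodule.span ℂ {v} ∧
      H *ᵥ v = t • v := by
    intro i
    obtain ⟨v, hv, hvf⟩ := exists_span_of_finrank (E.finrank_flag i)
    have hvi : v ∈ E.flag i := by rw [hvf]; exact Submodule.mem_span_singleton_self v
    have h1 : H *ᵥ v ∈ E.flag i := by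
      rw [mem_flag_iff (hE i), Matrix.mulVec_mulVec, hH, Matrix.neg_mulVec, ← Matrix.mulVec_mulVec,
        E.res_flag_eq_zero i v hvi, Matrix.mulVec_zero, neg_zero]
    rw [hvf] at h1
    obtain ⟨t, ht⟩ := Submodule.mem_span_singleton.1 h1
    refine ⟨v, t, hv, ?_, hvf, ht.symm⟩
    rintro rfl
    rw [zero_smul] at ht
    exact hv (Matrix.eq_zero_of_mulVec_eq_zero hdet ht.symm)
  choose v t hv ht hf hHv using key
  have hvi : ∀ i, v i ∈ E.flag i := fun i => by
    rw [hf]; exact Submodule.mem_span_singleton_self _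
  -- The residue at `i₀` sends `v k` to a nonzero multiple of `v i₀`; anticommuting with `H`, it
  -- reverses the sign of the eigenvalue.
  have htk : t k = -t i₀ := by
    have h1 := E.res_mem_flag i₀ (v k)
    rw [hf i₀] at h1
    obtain ⟨b, hb⟩ := Submodule.mem_span_singleton.1 h1
    have hb0 : b ≠ 0 := by
      rintro rfl
      rw [zero_smul] at hb
      have h2 := (mem_flag_iff (hE i₀)).2 hb.symm
      exact hk ((hf k).trans (eq_span_of_mem (E.finrank_flag i₀) (hv k) h2).symm)
    have h3 := congrArg (· *ᵥ v k) (hH i₀)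
    simp only [Matrix.neg_mulVec, ← Matrix.mulVec_mulVec, hHv, Matrix.mulVec_smul, ← hb] at h3
    rw [← sub_eq_zero, sub_neg_eq_add, smul_smul, smul_smul, ← add_smul] at h3
    have h4 := (smul_eq_zero.1 h3).resolve_right (hv i₀)
    apply mul_right_cancel₀ hb0
    linear_combination h4
  have hc := isCompl_of_finrank_eq_one (E.finrank_flag i₀) (E.finrank_flag k) hk.symm
  have h1 : v i ∈ E.flag i₀ ⊔ E.flag k := by rw [hc.sup_eq_top]; trivial
  obtain ⟨y, hy, z, hz, hyz⟩ := Submodule.mem_sup.1 h1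
  rw [hf i₀] at hy
  rw [hf k] at hz
  obtain ⟨p, rfl⟩ := Submodule.mem_span_singleton.1 hy
  obtain ⟨q, rfl⟩ := Submodule.mem_span_singleton.1 hz
  have h2 : t i • v i = t i₀ • p • v i₀ - t i₀ • q • v k := by
    rw [← hHv, ← hyz, Matrix.mulVec_add, Matrix.mulVec_smul, Matrix.mulVec_smul, hHv, hHv, htk]
    module
  have h3 : (t i - t i₀) • v i = (-2 * t i₀ * q) • v k := by
    rw [sub_smul, h2, ← hyz]; module
  have h4 : (t i + t i₀) • v i = (2 * t i₀ * p) • v i₀ := by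
    rw [add_smul, h2, ← hyz]; module
  have hmem : ∀ j (r s : ℂ), r ≠ 0 → r • v i = s • v j → E.flag i = E.flag j := by
    intro j r s hr h
    have h5 : v i ∈ E.flag j := by
      rw [← Submodule.smul_mem_iff _ hr, h]
      exact Submodule.smul_mem _ _ (hvi j)
    rw [hf i, eq_span_of_mem (E.finrank_flag j) (hv i) h5]
  -- `H` is diagonal in the basis `v i₀`, `v k` with the distinct eigenvalues `t i₀` and `-t i₀`, so
  -- the eigenvector `v i` lies on one of the two axes.
  by_cases h5 : t i - t i₀ = 0
  · refine Or.inl (hmem _ _ _ (fun h6 => ht i₀ ?_) h4)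
    linear_combination (h6 - h5) / 2
  · exact Or.inr (hmem _ _ _ h5 h3)

/-- A matrix intertwining residues with their transposes becomes, after multiplication by the
right-angle rotation, one that anticommutes with all residues. At most two flag lines then occur,
and `S` collects the indices whose flag is that of `i₀`. -/
theorem exists_isNormalForm_of_theta_eq (hx : Function.Injective x) {E : Stable x}
    (h : Theta (Moduli.mk E) = Moduli.mk E) (i₀ : Fin n) :
    ∃ S, i₀ ∈ S ∧ ∃ G a, IsNormalForm E.1 S G a := by
  classical
  obtain ⟨K, hK, hKE⟩ := (theta_mk_eq_iff hx).1 h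
  obtain ⟨k, hk⟩ := exists_flag_ne hx E i₀
  have hJ : ∀ i, (E.1.res i)ᵀ * !![0, -1; 1, 0] = -(!![0, -1; 1, 0] * E.1.res i) := by
    intro i
    have htr := E.1.res_trace i
    rw [Matrix.trace_fin_two] at htr
    ext k l
    fin_cases k <;> fin_cases l <;> 
      simp [Matrix.mul_apply, Matrix.vecMul, dotProduct, Fin.sum_univ_two]
    · linear_combination -htr
    · linear_combination htr
  have hflag := flag_eq_or_of_anticomm E.2.1 (H := K * !![0, -1; 1, 0])
    (by simp [Matrix.det_fin_two_of, hK])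
    (fun i => by rw [← Matrix.mul_assoc, hKE, Matrix.mul_assoc, hJ]; simp only [Matrix.mul_neg,
      Matrix.mul_assoc]) hk
  obtain ⟨v, hv, hvf⟩ := exists_span_of_finrank (E.1.finrank_flag i₀)
  obtain ⟨w, hw, hwf⟩ := exists_span_of_finrank (E.1.finrank_flag k)
  set G : Matrix (Fin 2) (Fin 2) ℂ := Matrix.of fun k l => if l = 0 then v k else w k with hG
  have hG0 : G.col 0 = v := by ext k; simp [hG]
  have hG1 : G.col 1 = w := by ext k; simp [hG]
  refine ⟨Finset.univ.filter fun i => E.1.flag i = E.1.flag i₀, by simp, G,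
    exists_isNormalForm_of_flag (det_ne_zero_of_span_ne ?_ ?_ ?_) (fun i hi => ?_)
    (fun i hi => ?_)⟩
  · rwa [hG0]
  · rwa [hG1]
  · rw [hG0, hG1, ← hvf, ← hwf]
    exact hk.symm
  · rw [hG0, ← hvf]
    simpa using hi
  · rw [hG1, ← hwf]
    exact (hflag i).resolve_left (by simpa using hi)

theorem two_le_card_of_sum_eq_zero {S : Finset (Fin n)} {a : Fin n → ℂ} (ha : ∀ i, a i ≠ 0)
    (hS : S.Nonempty) (hs : ∑ i ∈ S, a i = 0) : 2 ≤ S.card := by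
  have h1 := hS.card_pos
  by_contra! h2
  obtain ⟨i, rfl⟩ := Finset.card_eq_one.1 (by omega : S.card = 1)
  exact ha i (by simpa using hs)

/-- Nonzero coefficients sum to zero over `S` and over its complement, so neither is a singleton.
The complement is nonempty since stability forbids all flags to agree. -/
theorem IsNormalForm.card_mem (hx : Function.Injective x) {E : Stable x} {S : Finset (Fin n)}
    {G : Matrix (Fin 2) (Fin 2) ℂ} {a : Fin n → ℂ} (h : IsNormalForm E.1 S G a)
    (hS : S.Nonempty) : 2 ≤ S.card ∧ S.card ≤ n - 2 := by
  have ha := h.ne_zero E.2.1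
  have hs := h.sum_eq_zero hx
  refine ⟨two_le_card_of_sum_eq_zero ha hS hs.1, ?_⟩
  have hc : Sᶜ.Nonempty := by
    obtain ⟨i, hi⟩ := hS
    obtain ⟨j, hj⟩ := exists_flag_ne hx E i
    refine ⟨j, Finset.mem_compl.2 fun hjS => hj ?_⟩
    rw [h.flag_eq E.2.1, h.flag_eq E.2.1, if_pos hi, if_pos hjS]
  have h1 := two_le_card_of_sum_eq_zero ha hc hs.2
  rw [Finset.card_compl, Fintype.card_fin] at h1
  omega

theorem theta_fixed_eq (hx : Function.Injective x) (i₀ : Fin n) :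
    {q : Moduli x | Theta q = q} =
      ⋃ S ∈ {S : Finset (Fin n) | i₀ ∈ S ∧ 2 ≤ S.card ∧ S.card ≤ n - 2}, ZSet x S := by
  ext q
  obtain ⟨E, rfl⟩ : ∃ E, Moduli.mk E = q := Quotient.exists_rep q
  simp only [Set.mem_iUnion, Set.mem_ofPred_eq, mk_mem_ZSet_iff hx, exists_prop]
  constructor
  · intro h
    obtain ⟨S, hS, G, a, hn⟩ := exists_isNormalForm_of_theta_eq hx h i₀
    exact ⟨S, ⟨hS, hn.card_mem hx ⟨_, hS⟩⟩, G, a, hn⟩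
  · rintro ⟨S, -, G, a, h⟩
    exact h.theta_eq hx

/-! ### Traces of products as invariant functions -/

/-- The trace of the product of the `i`-th and the `j`-th matrix of a tuple. -/
def traceProd (R : Fin n → Fin 2 → Fin 2 → ℂ) (i j : Fin n) : ℂ :=
  R i 0 0 * R j 0 0 + R i 0 1 * R j 1 0 + (R i 1 0 * R j 0 1 + R i 1 1 * R j 1 1)

theorem traceProd_residues (E : Stable x) (i j : Fin n) :
    traceProd (residues E) i j = (E.1.res i * E.1.res j).trace := by
  simp [traceProd, residues, Matrix.trace_fin_two, Matrix.mul_apply, Fin.sum_univ_two]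

theorem contDiff_traceProd (i j : Fin n) :
    ContDiff ℝ ∞ (fun R : Fin n → Fin 2 → Fin 2 → ℂ => traceProd R i j) := by
  have h : ∀ (i : Fin n) (k l : Fin 2),
      ContDiff ℝ ∞ (fun R : Fin n → Fin 2 → Fin 2 → ℂ => R i k l) := fun i k l => by fun_prop
  unfold traceProd
  exact (((h i 0 0).mul (h j 0 0)).add ((h i 0 1).mul (h j 1 0))).add
    (((h i 1 0).mul (h j 0 1)).add ((h i 1 1).mul (h j 1 1)))

theorem traceProd_eq_of_isIso {E E' : Stable x} (h : E ≈ E') (i j : Fin n) :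
    traceProd (residues E) i j = traceProd (residues E') i j := by
  obtain ⟨g, hg⟩ := h
  obtain ⟨G, hG, hGE⟩ := hg.exists_conj
  rw [traceProd_residues, traceProd_residues]
  have h1 : ∀ i, E.1.res i = G⁻¹ * E'.1.res i * G := fun i => by
    rw [Matrix.mul_assoc, hGE, Matrix.nonsing_inv_mul_cancel_left _ _ hG.isUnit]
  rw [h1 i, h1 j]
  have h2 : G⁻¹ * E'.1.res i * G * (G⁻¹ * E'.1.res j * G) =
      G⁻¹ * (E'.1.res i * E'.1.res j * G) := by
    simp only [Matrix.mul_assoc, Matrix.mul_nonsing_inv_cancel_left _ _ hG.isUnit]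
  rw [h2, Matrix.trace_mul_comm, Matrix.mul_nonsing_inv_cancel_right _ _ hG.isUnit]

/-- The trace of the product of two residues, as a function on the moduli space. -/
def Moduli.traceProd (i j : Fin n) : Moduli x → ℂ :=
  Quotient.lift (fun E => QPH.traceProd (residues E) i j) fun _ _ h => traceProd_eq_of_isIso h i j

theorem Moduli.traceProd_mk (i j : Fin n) (E : Stable x) :
    Moduli.traceProd i j (Moduli.mk E) = QPH.traceProd (residues E) i j := rfl

theorem Moduli.continuous_traceProd (i j : Fin n) :
    Continuous (Moduli.traceProd (x := x) i j) :=
  ((contDiff_traceProd i j).continuous.comp continuous_induced_dom).quotient_lift _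

theorem Moduli.continuous_mk : Continuous (Moduli.mk (x := x)) := continuous_quotient_mk'

/-- Conjugation drops out, and two elementary off-diagonal matrices have a product with nonzero
trace only if they are of opposite type. These invariants both detect `S` and serve as coordinates.
-/
theorem IsNormalForm.traceProd_eq {E : Stable x} {S : Finset (Fin n)}
    {G : Matrix (Fin 2) (Fin 2) ℂ} {a : Fin n → ℂ} (h : IsNormalForm E.1 S G a) (i j : Fin n) :
    Moduli.traceProd i j (Moduli.mk E) = if i ∈ S ↔ j ∈ S then 0 else a i * a j := by
  have h1 : ∀ i, E.1.res i = G * offDiag S a i * G⁻¹ := fun i => by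
    rw [← h.2, Matrix.mul_nonsing_inv_cancel_right _ _ h.1.isUnit]
  have h2 : G * offDiag S a i * G⁻¹ * (G * offDiag S a j * G⁻¹) =
      G * (offDiag S a i * offDiag S a j * G⁻¹) := by
    simp only [Matrix.mul_assoc, Matrix.nonsing_inv_mul_cancel_left _ _ h.1.isUnit]
  rw [Moduli.traceProd_mk, traceProd_residues, h1 i, h1 j, h2, Matrix.trace_mul_comm,
    Matrix.nonsing_inv_mul_cancel_right _ _ h.1.isUnit]
  by_cases hi : i ∈ S <;> by_cases hj : j ∈ S <;>
    simp [offDiag, hi, hj, Matrix.trace_fin_two]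

/-! ### Parameters for the normal forms of type `S` -/

/-- Two indices in `S` and one index outside `S`. -/
structure Pivots (S : Finset (Fin n)) where
  i₀ : Fin n
  i₁ : Fin n
  j₀ : Fin n
  i₀_mem : i₀ ∈ S
  i₁_mem : i₁ ∈ S
  j₀_notMem : j₀ ∉ S
  i₁_ne : i₁ ≠ i₀

namespace Pivots

variable {S : Finset (Fin n)} (p : Pivots S)

/-- The indices that are not pivots. -/
abbrev Free : Type := {i : Fin n // i ≠ p.i₀ ∧ i ≠ p.i₁ ∧ i ≠ p.j₀}

theorem j₀_ne_i₀ : p.j₀ ≠ p.i₀ := fun h => p.j₀_notMem (h ▸ p.i₀_mem)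

theorem j₀_ne_i₁ : p.j₀ ≠ p.i₁ := fun h => p.j₀_notMem (h ▸ p.i₁_mem)

theorem univ_eq : (Finset.univ : Finset (Fin n)) = insert p.i₀ (insert p.i₁ (insert p.j₀
    (Finset.univ.filter fun i => i ≠ p.i₀ ∧ i ≠ p.i₁ ∧ i ≠ p.j₀))) := by
  ext i
  simp only [Finset.mem_univ, Finset.mem_insert, Finset.mem_filter, true_and, true_iff]
  tauto

theorem sum_eq {M : Type*} [AddCommMonoid M] (f : Fin n → M) :
    ∑ i, f i = f p.i₀ + (f p.i₁ + (f p.j₀ + ∑ k : p.Free, f k)) := by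
  rw [p.univ_eq, Finset.sum_insert, Finset.sum_insert, Finset.sum_insert]
  · rw [← Finset.sum_subtype_eq_sum_filter, Finset.subtype_univ]
  · simp
  · simp [p.j₀_ne_i₁.symm]
  · simp [p.i₁_ne.symm, p.j₀_ne_i₀.symm]

theorem card_free : Fintype.card p.Free = n - 3 := by
  have h := p.sum_eq fun _ => 1
  simp only [Finset.sum_const, Finset.card_univ, Fintype.card_fin, smul_eq_mul, mul_one] at h
  omega

/-- The coefficients of the normal form, in terms of those at the indices that are not pivots. -/
noncomputable def coeff (y : p.Free → ℂ) (i : Fin n) : ℂ :=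
  if h : i ≠ p.i₀ ∧ i ≠ p.i₁ ∧ i ≠ p.j₀ then y ⟨i, h⟩
  else if i = p.i₀ then 1
  else if i = p.i₁ then -1 - ∑ k : p.Free, if (k : Fin n) ∈ S then y k else 0
  else -∑ k : p.Free, if (k : Fin n) ∈ S then 0 else y k

theorem coeff_free (y : p.Free → ℂ) (k : p.Free) : p.coeff y k = y k := by
  rw [coeff, dif_pos k.2]

theorem coeff_i₀ (y : p.Free → ℂ) : p.coeff y p.i₀ = 1 := by
  simp [coeff]

theorem coeff_i₁ (y : p.Free → ℂ) :
    p.coeff y p.i₁ = -1 - ∑ k : p.Free, if (k : Fin n) ∈ S then y k else 0 := by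
  simp [coeff, p.i₁_ne]

theorem coeff_j₀ (y : p.Free → ℂ) :
    p.coeff y p.j₀ = -∑ k : p.Free, if (k : Fin n) ∈ S then 0 else y k := by
  simp [coeff, p.j₀_ne_i₀, p.j₀_ne_i₁]

theorem cases_index {P : Fin n → Prop} (h0 : P p.i₀) (h1 : P p.i₁) (h2 : P p.j₀)
    (h : ∀ k : p.Free, P k) (i : Fin n) : P i := by
  by_cases hi : i ≠ p.i₀ ∧ i ≠ p.i₁ ∧ i ≠ p.j₀
  · exact h ⟨i, hi⟩
  · have h3 : i = p.i₀ ∨ i = p.i₁ ∨ i = p.j₀ := by tauto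
    rcases h3 with rfl | rfl | rfl <;> assumption

theorem sum_mem_eq (a : Fin n → ℂ) :
    ∑ i ∈ S, a i = a p.i₀ + (a p.i₁ + ∑ k : p.Free, if (k : Fin n) ∈ S then a k else 0) := by
  have h := p.sum_eq fun i => if i ∈ S then a i else 0
  simpa [p.i₀_mem, p.i₁_mem, p.j₀_notMem] using h

theorem sum_compl_eq (a : Fin n → ℂ) :
    ∑ i ∈ Sᶜ, a i = a p.j₀ + ∑ k : p.Free, if (k : Fin n) ∈ S then 0 else a k := by
  have h := p.sum_eq fun i => if i ∈ S then 0 else a i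
  have hS : Sᶜ = Finset.univ.filter fun i => i ∉ S := by ext; simp
  rw [hS]
  simpa [p.i₀_mem, p.i₁_mem, p.j₀_notMem, Finset.sum_ite] using h

theorem sum_coeff (y : p.Free → ℂ) :
    ∑ i ∈ S, p.coeff y i = 0 ∧ ∑ i ∈ Sᶜ, p.coeff y i = 0 := by
  rw [p.sum_mem_eq, p.sum_compl_eq, coeff_i₀, coeff_i₁, coeff_j₀]
  simp only [coeff_free]
  constructor <;> ring

/-- The normalization fixes the value at `i₀`, and the two sum conditions are solved for the values
at `i₁` and `j₀`. -/
theorem coeff_restrict {a : Fin n → ℂ} (h0 : a p.i₀ = 1) (h1 : ∑ i ∈ S, a i = 0)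
    (h2 : ∑ i ∈ Sᶜ, a i = 0) : p.coeff (fun k => a k) = a := by
  rw [p.sum_mem_eq, h0] at h1
  rw [p.sum_compl_eq] at h2
  refine funext (p.cases_index ?_ ?_ ?_ fun k => p.coeff_free _ k)
  · rw [coeff_i₀, h0]
  · rw [coeff_i₁]; linear_combination -h1
  · rw [coeff_j₀]; linear_combination -h2

/-- Each coefficient is an affine function of the parameters. Restricted to a complex line it has at
most one zero unless it vanishes identically, as needed in `isPreconnected_domain`. -/
theorem coeff_line (y z : p.Free → ℂ) (t : ℂ) (i : Fin n) :
    p.coeff (y + t • (z - y)) i = p.coeff y i + t * (p.coeff z i - p.coeff y i) := by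
  revert i
  refine p.cases_index ?_ ?_ ?_ fun k => ?_
  · simp only [coeff_i₀]; ring
  · have h : ∀ k : p.Free, (if (k : Fin n) ∈ S then (y + t • (z - y)) k else 0) =
        (if (k : Fin n) ∈ S then y k else 0) + t * ((if (k : Fin n) ∈ S then z k else 0) -
          (if (k : Fin n) ∈ S then y k else 0)) := fun k => by split_ifs <;> simp
    simp only [coeff_i₁, h, Finset.sum_add_distrib, ← Finset.mul_sum, Finset.sum_sub_distrib]
    ring
  · have h : ∀ k : p.Free, (if (k : Fin n) ∈ S then 0 else (y + t • (z - y)) k) =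
        (if (k : Fin n) ∈ S then 0 else y k) + t * ((if (k : Fin n) ∈ S then 0 else z k) -
          (if (k : Fin n) ∈ S then 0 else y k)) := fun k => by split_ifs <;> simp
    simp only [coeff_j₀, h, Finset.sum_add_distrib, ← Finset.mul_sum, Finset.sum_sub_distrib]
    ring
  · simp only [coeff_free]; simp

theorem contDiff_coeff (i : Fin n) : ContDiff ℝ ∞ (fun y => p.coeff y i) := by
  revert i
  refine p.cases_index ?_ ?_ ?_ fun k => ?_
  · simp only [coeff_i₀]; fun_prop
  · simp only [coeff_i₁]
    refine contDiff_const.sub (ContDiff.sum fun k _ => ?_)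
    split_ifs <;> fun_prop
  · simp only [coeff_j₀]
    refine (ContDiff.sum fun k _ => ?_).neg
    split_ifs <;> fun_prop
  · simp only [coeff_free]; fun_prop

/-- The parameters for which no coefficient of the normal form vanishes. -/
def domain : Set (p.Free → ℂ) := {y | ∀ i, p.coeff y i ≠ 0}

theorem isOpen_domain : IsOpen p.domain := by
  have h : p.domain = ⋂ i, {y | p.coeff y i ≠ 0} := by ext; simp [domain]
  rw [h]
  exact isOpen_iInter_of_finite fun i => isOpen_ne_fun (p.contDiff_coeff i).continuous
    continuous_const

theorem domain_nonempty (h : S.card ≤ n - 2) : p.domain.Nonempty := by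
  -- With all free parameters equal to 1, the coefficients at `i₁` and `j₀` are negatives of
  -- cardinalities: `|S| - 1` and `n - |S| - 1`.
  refine ⟨fun _ => 1, p.cases_index ?_ ?_ ?_ fun k => ?_⟩
  · simp [coeff_i₀]
  · rw [coeff_i₁, Finset.sum_boole]
    intro h0
    have h1 : ((Finset.univ.filter fun k : p.Free => (k : Fin n) ∈ S).card + 1 : ℂ) = 0 := by
      linear_combination -h0
    exact Nat.cast_add_one_ne_zero _ h1
  · have h1 := p.sum_compl_eq fun _ => 1
    rw [coeff_j₀]
    intro h0
    rw [neg_eq_zero.1 h0, Finset.sum_const, Finset.card_compl, Fintype.card_fin] at h1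
    have h2 : n - S.card = 1 := by
      have h3 : ((n - S.card : ℕ) : ℂ) = (1 : ℕ) := by simpa using h1
      exact_mod_cast h3
    -- Positivity of `|S|` excludes the case in which the natural subtraction `n - 2` truncates.
    have h4 := Finset.card_pos.2 ⟨_, p.i₀_mem⟩
    omega
  · simp [coeff_free]

/-- On the complex line through two points of the domain each coefficient vanishes at most once,
being nonzero at the first point. The plane `ℂ` minus a countable set is path connected. -/
theorem isPreconnected_domain : IsPreconnected p.domain := by
  refine isPreconnected_of_forall_pair fun y hy z hz => ?_
  set T : Set ℂ := {t | y + t • (z - y) ∈ p.domain}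
  have hT : Tᶜ.Countable := by
    have h1 : Tᶜ ⊆ ⋃ i, {t | p.coeff y i + t * (p.coeff z i - p.coeff y i) = 0} := by
      intro t ht
      simpa [T, domain, coeff_line] using ht
    refine (Set.countable_iUnion fun i => Set.Subsingleton.countable ?_).mono h1
    intro s hs t ht
    simp only [Set.mem_ofPred_eq] at hs ht
    have h2 : p.coeff z i - p.coeff y i ≠ 0 := fun h0 => hy i (by simpa [h0] using hs)
    exact mul_right_cancel₀ h2 (by linear_combination hs - ht)
  have hT' : IsPreconnected T := by
    have h1 := hT.isPathConnected_compl_of_one_lt_rank (by simp [Complex.rank_real_complex])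
    rw [compl_compl] at h1
    exact h1.isConnected.isPreconnected
  refine ⟨(fun t => y + t • (z - y)) '' T, ?_, ⟨0, ?_, by simp⟩, ⟨1, ?_, by simp⟩,
    hT'.image _ (by fun_prop)⟩
  · rintro _ ⟨t, ht, rfl⟩
    exact ht
  · simpa [T] using hy
  · simpa [T] using hz

/-- The coefficients of the normal form in which the one at `i₀` is `1`, in terms of the traces
`τ i j` of the products of residues. -/
noncomputable def coeffOfTrace (τ : Fin n → Fin n → ℂ) (i : Fin n) : ℂ :=
  if i ∈ S then τ i p.j₀ * (τ p.i₀ p.j₀)⁻¹ else τ p.i₀ i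

/-- The coefficients of the normal form, as functions on the moduli space. -/
noncomputable def moduliCoeff (q : Moduli x) : Fin n → ℂ :=
  p.coeffOfTrace fun i j => Moduli.traceProd i j q

/-- The quotient of traces cancels `a p.j₀`. The resulting values are unchanged by diagonal
rescaling of the frame and are the coefficients of the representative equal to 1 at `i₀`. -/
theorem moduliCoeff_mk {E : Stable x} {G : Matrix (Fin 2) (Fin 2) ℂ} {a : Fin n → ℂ}
    (h : IsNormalForm E.1 S G a) (i : Fin n) :
    p.moduliCoeff (Moduli.mk E) i = if i ∈ S then a i / a p.i₀ else a p.i₀ * a i := by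
  have h0 := h.ne_zero E.2.1 p.i₀
  have h1 := h.ne_zero E.2.1 p.j₀
  unfold moduliCoeff coeffOfTrace
  simp only [h.traceProd_eq]
  by_cases hi : i ∈ S
  · simp only [hi, p.i₀_mem, p.j₀_notMem, if_true, iff_false, not_true, if_false]
    field_simp
  · simp [hi, p.i₀_mem]

theorem isNormalForm_moduliCoeff {E : Stable x} {G : Matrix (Fin 2) (Fin 2) ℂ} {a : Fin n → ℂ}
    (h : IsNormalForm E.1 S G a) :
    IsNormalForm E.1 S (G * !![a p.i₀, 0; 0, 1]) (p.moduliCoeff (Moduli.mk E)) := by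
  have h0 := h.ne_zero E.2.1 p.i₀
  refine ⟨?_, fun i => ?_⟩
  · simp [Matrix.det_fin_two_of, h.1, h0]
  · rw [← Matrix.mul_assoc, h.2, Matrix.mul_assoc, Matrix.mul_assoc]
    congr 1
    unfold offDiag
    rw [p.moduliCoeff_mk h]
    split_ifs <;> ext k l <;> fin_cases k <;> fin_cases l <;> simp [h0, mul_comm, mul_div_cancel₀]

theorem coeff_moduliCoeff (hx : Function.Injective x) {q : Moduli x} (hq : q ∈ ZSet x S) :
    p.coeff (fun k => p.moduliCoeff q k) = p.moduliCoeff q := by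
  obtain ⟨E, rfl⟩ : ∃ E, Moduli.mk E = q := Quotient.exists_rep q
  obtain ⟨G, a, h⟩ := (mk_mem_ZSet_iff hx).1 hq
  have hs := (p.isNormalForm_moduliCoeff h).sum_eq_zero hx
  refine p.coeff_restrict ?_ hs.1 hs.2
  rw [p.moduliCoeff_mk h, if_pos p.i₀_mem, div_self (h.ne_zero E.2.1 _)]

theorem restrict_moduliCoeff_mem (hx : Function.Injective x) {q : Moduli x} (hq : q ∈ ZSet x S) :
    (fun k : p.Free => p.moduliCoeff q k) ∈ p.domain := by
  intro i
  rw [p.coeff_moduliCoeff hx hq]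
  obtain ⟨E, rfl⟩ : ∃ E, Moduli.mk E = q := Quotient.exists_rep q
  obtain ⟨G, a, h⟩ := (mk_mem_ZSet_iff hx).1 hq
  exact (p.isNormalForm_moduliCoeff h).ne_zero E.2.1 i

end Pivots

/-! ### The global chart of `𝒵_S` -/

theorem contDiff_offDiag_coeff {S : Finset (Fin n)} (p : Pivots S) :
    ContDiff ℝ ∞ (fun (y : p.Free → ℂ) (i : Fin n) (k l : Fin 2) => offDiag S (p.coeff y) i k l) := by
  refine contDiff_pi.2 fun i => contDiff_pi.2 fun k => contDiff_pi.2 fun l => ?_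
  have h := p.contDiff_coeff i
  unfold offDiag
  split_ifs <;> fin_cases k <;> fin_cases l <;> simp <;> first | exact h | exact contDiff_const

namespace Pivots

variable {S : Finset (Fin n)} (p : Pivots S)

/-- The family `s` of stable Higgs bundles has the residues that are the normal forms with the given
parameters. -/
def IsFamily (s : (p.Free → ℂ) → Stable x) : Prop :=
  ∀ y ∈ p.domain, ∀ i, (s y).1.res i = offDiag S (p.coeff y) i

variable {p} {s : (p.Free → ℂ) → Stable x}

theorem IsFamily.isNormalForm (hs : p.IsFamily s) {y : p.Free → ℂ} (hy : y ∈ p.domain) :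
    IsNormalForm (s y).1 S 1 (p.coeff y) :=
  ⟨by simp, fun i => by rw [hs y hy, mul_one, one_mul]⟩

theorem IsFamily.residues_eqOn (hs : p.IsFamily s) :
    Set.EqOn (fun y => residues (s y)) (fun y i k l => offDiag S (p.coeff y) i k l) p.domain :=
  fun y hy => by funext i k l; simp only [residues, hs y hy]

theorem IsFamily.continuousOn (hs : p.IsFamily s) : ContinuousOn s p.domain := by
  rw [continuousOn_iff_continuous_domRestrict]
  refine continuous_induced_rng.2 ?_
  have h := (contDiff_offDiag_coeff p).continuous.continuousOn.congr hs.residues_eqOn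
  exact continuousOn_iff_continuous_domRestrict.1 h

theorem IsFamily.mk_mem (hs : p.IsFamily s) (hx : Function.Injective x) {y : p.Free → ℂ}
    (hy : y ∈ p.domain) : Moduli.mk (s y) ∈ ZSet x S :=
  (mk_mem_ZSet_iff hx).2 ⟨_, _, hs.isNormalForm hy⟩

theorem IsFamily.moduliCoeff_mk (hs : p.IsFamily s) {y : p.Free → ℂ} (hy : y ∈ p.domain)
    (k : p.Free) : p.moduliCoeff (Moduli.mk (s y)) k = y k := by
  rw [p.moduliCoeff_mk (hs.isNormalForm hy), coeff_i₀, coeff_free, div_one, one_mul, ite_self]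

theorem IsFamily.mk_restrict (hs : p.IsFamily s) (hx : Function.Injective x) {q : Moduli x}
    (hq : q ∈ ZSet x S) : Moduli.mk (s fun k => p.moduliCoeff q k) = q := by
  have h1 := hs _ (p.restrict_moduliCoeff_mem hx hq)
  rw [p.coeff_moduliCoeff hx hq] at h1
  obtain ⟨E, rfl⟩ : ∃ E, Moduli.mk E = q := Quotient.exists_rep q
  obtain ⟨G, a, h⟩ := (mk_mem_ZSet_iff hx).1 hq
  have h2 := p.isNormalForm_moduliCoeff h
  exact (mk_eq_mk_iff hx).2 ⟨_, h2.1, fun i => by rw [h2.2, h1]⟩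

theorem traceProd_ne_zero (p : Pivots S) (hx : Function.Injective x) {q : Moduli x}
    (hq : q ∈ ZSet x S) : Moduli.traceProd p.i₀ p.j₀ q ≠ 0 := by
  obtain ⟨E, rfl⟩ : ∃ E, Moduli.mk E = q := Quotient.exists_rep q
  obtain ⟨G, a, h⟩ := (mk_mem_ZSet_iff hx).1 hq
  rw [h.traceProd_eq]
  simp [p.i₀_mem, p.j₀_notMem, h.ne_zero E.2.1]

theorem continuousOn_moduliCoeff (p : Pivots S) (hx : Function.Injective x) (i : Fin n) :
    ContinuousOn (fun q : Moduli x => p.moduliCoeff q i) (ZSet x S) := by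
  unfold moduliCoeff coeffOfTrace
  by_cases hi : i ∈ S
  · simp only [hi, if_true]
    exact (Moduli.continuous_traceProd _ _).continuousOn.mul
      ((Moduli.continuous_traceProd _ _).continuousOn.inv₀ fun q hq => p.traceProd_ne_zero hx hq)
  · simp only [hi, if_false]
    exact (Moduli.continuous_traceProd _ _).continuousOn

/-- The set `𝒵_S` is parametrized by the coefficients of the normal form. -/
noncomputable def IsFamily.homeomorph (hs : p.IsFamily s) (hx : Function.Injective x) :
    ZSet x S ≃ₜ p.domain where
  toFun q := ⟨fun k => p.moduliCoeff q.1 k, p.restrict_moduliCoeff_mem hx q.2⟩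
  invFun y := ⟨Moduli.mk (s y.1), hs.mk_mem hx y.2⟩
  left_inv q := Subtype.ext (hs.mk_restrict hx q.2)
  right_inv y := Subtype.ext (funext fun k => hs.moduliCoeff_mk y.2 k)
  continuous_toFun := by
    refine Continuous.subtype_mk (continuous_pi fun k => ?_) _
    exact continuousOn_iff_continuous_domRestrict.1 (p.continuousOn_moduliCoeff hx k)
  continuous_invFun := Continuous.subtype_mk
    (Moduli.continuous_mk.comp (continuousOn_iff_continuous_domRestrict.1 hs.continuousOn)) _

/-- Real linear coordinates on the parameter space. -/
noncomputable def euclid (p : Pivots S) :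
    (p.Free → ℂ) ≃L[ℝ] EuclideanSpace ℝ (Fin (2 * (n - 3))) :=
  ContinuousLinearEquiv.ofFinrankEq (by
    rw [Module.finrank_pi_fintype, Finset.sum_const, Complex.finrank_real_complex,
      finrank_euclideanSpace_fin, Finset.card_univ, p.card_free, smul_eq_mul, mul_comm])

theorem contDiffOn_coeffOfTrace (p : Pivots S) (i : Fin n) :
    ContDiffOn ℝ ∞ (fun R : Fin n → Fin 2 → Fin 2 → ℂ => p.coeffOfTrace (traceProd R) i)
      {R | traceProd R p.i₀ p.j₀ ≠ 0} := by
  unfold coeffOfTrace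
  by_cases hi : i ∈ S
  · simp only [hi, if_true]
    exact (contDiff_traceProd _ _).contDiffOn.mul
      ((contDiff_traceProd _ _).contDiffOn.inv fun R hR => hR)
  · simp only [hi, if_false]
    exact (contDiff_traceProd _ _).contDiffOn

/-- The coordinates on `𝒵_S`. -/
noncomputable def coord (p : Pivots S) (q : ZSet x S) : EuclideanSpace ℝ (Fin (2 * (n - 3))) :=
  p.euclid fun k => p.moduliCoeff q.1 k

theorem IsFamily.isOpenEmbedding_coord (hs : p.IsFamily s) (hx : Function.Injective x) :
    Topology.IsOpenEmbedding (p.coord (x := x)) :=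
  p.euclid.toHomeomorph.isOpenEmbedding.comp
    (p.isOpen_domain.isOpenEmbedding_subtypeVal.comp (hs.homeomorph hx).isOpenEmbedding)

/-- The coordinates are rational in the residues, with denominator a trace that never vanishes on
`𝒵_S`; the inverse is represented by a family whose residues are affine in the parameters. -/
theorem IsFamily.isSmoothChart (hs : p.IsFamily s) (hx : Function.Injective x)
    [Nonempty (ZSet x S)] :
    IsSmoothChart ((hs.isOpenEmbedding_coord hx).toOpenPartialHomeomorph (p.coord (x := x))) := by
  refine ⟨fun E hE _ => ⟨{R | traceProd R p.i₀ p.j₀ ≠ 0}, ?_, p.traceProd_ne_zero hx hE,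
    fun R => p.euclid fun k => p.coeffOfTrace (traceProd R) k, ?_, fun E' hE' _ _ => rfl⟩, ?_⟩
  · exact isOpen_ne_fun (contDiff_traceProd _ _).continuous continuous_const
  · exact p.euclid.contDiff.comp_contDiffOn
      (contDiffOn_pi.2 fun k => p.contDiffOn_coeffOfTrace k)
  · intro y hy
    have hdom : ∀ t ∈ ((hs.isOpenEmbedding_coord hx).toOpenPartialHomeomorph
        (p.coord (x := x))).target, ∃ q : ZSet x S, p.coord q = t := by
      intro t ht
      simpa using ht
    refine ⟨_, OpenPartialHomeomorph.open_target _, hy, subset_rfl, fun t => s (p.euclid.symm t),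
      ?_, fun t ht => ?_⟩
    · have h1 := (contDiff_offDiag_coeff p).contDiffOn.congr hs.residues_eqOn
      refine h1.comp p.euclid.symm.contDiff.contDiffOn fun t ht => ?_
      obtain ⟨q, rfl⟩ := hdom t ht
      rw [coord, ContinuousLinearEquiv.symm_apply_apply]
      exact p.restrict_moduliCoeff_mem hx q.2
    · obtain ⟨q, rfl⟩ := hdom t ht
      rw [Topology.IsOpenEmbedding.toOpenPartialHomeomorph_left_inv, coord]
      dsimp only
      rw [ContinuousLinearEquiv.symm_apply_apply, hs.mk_restrict hx q.2]

theorem exists_isFamily (p : Pivots S) (hx : Function.Injective x) (h : S.card ≤ n - 2) :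
    ∃ s : (p.Free → ℂ) → Stable x, p.IsFamily s := by
  have key : ∀ y ∈ p.domain, ∃ E : Stable x, ∀ i, E.1.res i = offDiag S (p.coeff y) i := by
    intro y hy
    -- The pivots `i₀` and `j₀` lie on opposite sides of `S` and so witness stability.
    have h0 : offDiag S (p.coeff y) p.i₀ * offDiag S (p.coeff y) p.j₀ ≠ 0 := by
      intro h0
      have h1 := congrFun (congrFun h0 0) 0
      simp only [offDiag, p.i₀_mem, p.j₀_notMem] at h1
      simp [hy p.i₀, hy p.j₀] at h1
    exact ⟨⟨_, isStable_ofResidues hx (fun i => mt offDiag_eq_zero_iff.1 (hy i))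
      (offDiag_mul_self S _) (sum_offDiag_eq_zero_iff.2 (p.sum_coeff y)) h0⟩, fun i => rfl⟩
  -- One stable bundle is needed as a default value of the family off the domain.
  obtain ⟨y₀, hy₀⟩ := p.domain_nonempty h
  obtain ⟨E₀, -⟩ := key y₀ hy₀
  have key' : ∀ y, ∃ E : Stable x, y ∈ p.domain → ∀ i, E.1.res i = offDiag S (p.coeff y) i := by
    intro y
    by_cases hy : y ∈ p.domain
    · obtain ⟨E, hE⟩ := key y hy
      exact ⟨E, fun _ => hE⟩
    · exact ⟨E₀, fun h => absurd h hy⟩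
  choose s hs using key'
  exact ⟨s, hs⟩

end Pivots

/-! ### Geometry of a single `𝒵_S` -/

theorem exists_pivots {S : Finset (Fin n)} (h2 : 2 ≤ S.card) (hn : S.card ≤ n - 2) :
    Nonempty (Pivots S) := by
  obtain ⟨i, hi, j, hj, hij⟩ := Finset.one_lt_card.1 h2
  have h1 : 0 < Sᶜ.card := by
    rw [Finset.card_compl, Fintype.card_fin]
    omega
  obtain ⟨k, hk⟩ := Finset.card_pos.1 h1
  exact ⟨⟨i, j, k, hi, hj, Finset.mem_compl.1 hk, hij.symm⟩⟩

variable {S : Finset (Fin n)}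

theorem ZSet_nonempty (hx : Function.Injective x) (h2 : 2 ≤ S.card) (hn : S.card ≤ n - 2) :
    (ZSet x S).Nonempty := by
  obtain ⟨p⟩ := exists_pivots h2 hn
  obtain ⟨s, hs⟩ := p.exists_isFamily hx hn
  obtain ⟨y, hy⟩ := p.domain_nonempty hn
  exact ⟨_, hs.mk_mem hx hy⟩

theorem isPreconnected_ZSet (hx : Function.Injective x) (h2 : 2 ≤ S.card) (hn : S.card ≤ n - 2) :
    IsPreconnected (ZSet x S) := by
  obtain ⟨p⟩ := exists_pivots h2 hn
  obtain ⟨s, hs⟩ := p.exists_isFamily hx hn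
  have h : ZSet x S = (fun y => Moduli.mk (s y)) '' p.domain := by
    ext q
    constructor
    · intro hq
      exact ⟨_, p.restrict_moduliCoeff_mem hx hq, hs.mk_restrict hx hq⟩
    · rintro ⟨y, hy, rfl⟩
      exact hs.mk_mem hx hy
  rw [h]
  exact p.isPreconnected_domain.image _ (Moduli.continuous_mk.comp_continuousOn hs.continuousOn)

theorem isSubmanifoldOfDim_ZSet (hx : Function.Injective x) (h2 : 2 ≤ S.card)
    (hn : S.card ≤ n - 2) : IsSubmanifoldOfDim (ZSet x S) (2 * (n - 3)) := by
  obtain ⟨p⟩ := exists_pivots h2 hn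
  obtain ⟨s, hs⟩ := p.exists_isFamily hx hn
  have he := hs.isOpenEmbedding_coord hx
  have := (ZSet_nonempty hx h2 hn).to_subtype
  refine ⟨he.isEmbedding.t2Space, he.isEmbedding.secondCountableTopology,
    he.singletonChartedSpace, he.isManifold_singleton, fun e h => ?_⟩
  rw [OpenPartialHomeomorph.singletonChartedSpace_mem_atlas_eq _ (by simp) e h]
  exact hs.isSmoothChart hx

/-- Compactness would make the parameter domain clopen and nonempty, hence the whole vector space;
but a free coefficient vanishes at the origin. -/
theorem not_isCompact_ZSet (hx : Function.Injective x) (h2 : 2 ≤ S.card) (hn : S.card ≤ n - 2) :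
    ¬ IsCompact (ZSet x S) := by
  obtain ⟨p⟩ := exists_pivots h2 hn
  obtain ⟨s, hs⟩ := p.exists_isFamily hx hn
  intro h
  have := isCompact_iff_compactSpace.1 h
  have := (hs.homeomorph hx).compactSpace
  have h1 : IsCompact p.domain := isCompact_iff_compactSpace.2 inferInstance
  have h3 := IsClopen.eq_univ ⟨h1.isClosed, p.isOpen_domain⟩ (p.domain_nonempty hn)
  -- The bounds on `|S|` force `n ≥ 4`, so a free parameter exists.
  have h4 : 0 < Fintype.card p.Free := by rw [p.card_free]; omega
  obtain ⟨k⟩ := Fintype.card_pos_iff.1 h4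
  have h5 : (0 : p.Free → ℂ) ∈ p.domain := by rw [h3]; trivial
  exact h5 k (p.coeff_free 0 k)

/-! ### Connected components of the fixed-point set -/

/-- If a space is the disjoint union of nonempty open connected subsets, these are its connected
components. -/
theorem exists_bijective_connectedComponents {X ι : Type*} [TopologicalSpace X] {Z : ι → Set X}
    (ho : ∀ i, IsOpen (Z i)) (hne : ∀ i, (Z i).Nonempty) (hc : ∀ i, IsPreconnected (Z i))
    (hd : ∀ i j, (Z i ∩ Z j).Nonempty → i = j) (hu : ∀ q, ∃ i, q ∈ Z i) :
    ∃ f : ι → ConnectedComponents X, Function.Bijective f := by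
  have hcl : ∀ i, IsClopen (Z i) := by
    refine fun i => ⟨⟨?_⟩, ho i⟩
    have h : (Z i)ᶜ = ⋃ j ∈ {j | j ≠ i}, Z j := by
      ext q
      simp only [Set.mem_compl_iff, Set.mem_iUnion, Set.mem_ofPred_eq, exists_prop]
      constructor
      · intro hq
        obtain ⟨j, hj⟩ := hu q
        exact ⟨j, fun h => hq (h ▸ hj), hj⟩
      · rintro ⟨j, hji, hj⟩ hq
        exact hji (hd j i ⟨q, hj, hq⟩)
    rw [h]
    exact isOpen_biUnion fun j _ => ho j
  choose p hp using hne
  refine ⟨fun i => ConnectedComponents.mk (p i), fun i j hij => ?_, fun c => ?_⟩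
  · have h1 : p i ∈ connectedComponent (p j) := by
      rw [← ConnectedComponents.coe_eq_coe.1 hij]
      exact mem_connectedComponent
    exact hd i j ⟨p i, hp i, (hcl j).connectedComponent_subset (hp j) h1⟩
  · obtain ⟨q, rfl⟩ := ConnectedComponents.surjective_coe c
    obtain ⟨i, hi⟩ := hu q
    refine ⟨i, ConnectedComponents.coe_eq_coe'.2 ?_⟩
    exact (hc i).subset_connectedComponent hi (hp i)

/-- The set is recovered from the class: its members are the indices whose residue has trace-product
zero with the one at `i₀`. -/
theorem eq_of_mem_ZSet (hx : Function.Injective x) {S T : Finset (Fin n)} {i₀ : Fin n}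
    (hS : i₀ ∈ S) (hT : i₀ ∈ T) {q : Moduli x} (hqS : q ∈ ZSet x S) (hqT : q ∈ ZSet x T) :
    S = T := by
  obtain ⟨E, rfl⟩ : ∃ E, Moduli.mk E = q := Quotient.exists_rep q
  have key : ∀ S : Finset (Fin n), i₀ ∈ S → Moduli.mk E ∈ ZSet x S →
      ∀ i, i ∈ S ↔ Moduli.traceProd i₀ i (Moduli.mk E) = 0 := by
    intro S hS hq i
    obtain ⟨G, a, h⟩ := (mk_mem_ZSet_iff hx).1 hq
    rw [h.traceProd_eq]
    by_cases hi : i ∈ S <;> simp [hi, hS, h.ne_zero E.2.1]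
  ext i
  rw [key S hS hqS, key T hT hqT]

/-- A fixed class has some type `T` containing `i₀`, and the nonvanishing traces force `T` to
separate `S` from its complement. The point is openness: only finitely many nonvanishing conditions
on continuous functions appear. -/
theorem ZSet_eq_of_fixed (hx : Function.Injective x) {S : Finset (Fin n)} {i₀ : Fin n}
    (hS : i₀ ∈ S) (hn : Sᶜ.Nonempty) :
    ZSet x S = {q | Theta q = q} ∩
      ⋂ i ∈ S, ⋂ j ∈ Sᶜ, {q | Moduli.traceProd i j q ≠ 0} := by
  ext q
  obtain ⟨E, rfl⟩ : ∃ E, Moduli.mk E = q := Quotient.exists_rep q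
  simp only [Set.mem_inter_iff, Set.mem_iInter, Set.mem_ofPred_eq, Finset.mem_compl]
  constructor
  · intro hq
    obtain ⟨G, a, h⟩ := (mk_mem_ZSet_iff hx).1 hq
    refine ⟨h.theta_eq hx, fun i hi j hj => ?_⟩
    rw [h.traceProd_eq]
    simp [hi, hj, h.ne_zero E.2.1]
  · rintro ⟨hf, hq⟩
    obtain ⟨T, hT, G, a, h⟩ := exists_isNormalForm_of_theta_eq hx hf i₀
    have h1 : ∀ i ∈ S, ∀ j ∉ S, ¬ (i ∈ T ↔ j ∈ T) := fun i hi j hj hij => by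
      have h2 := hq i hi j hj
      rw [h.traceProd_eq, if_pos hij] at h2
      exact h2 rfl
    obtain ⟨k, hk⟩ := hn
    rw [Finset.mem_compl] at hk
    have hTS : T = S := by
      ext i
      have h3 := h1 i₀ hS k hk
      by_cases hi : i ∈ S
      · have h4 := h1 i hi k hk
        tauto
      · have h4 := h1 i₀ hS i hi
        tauto
    exact (mk_mem_ZSet_iff hx).2 ⟨G, a, hTS ▸ h⟩

theorem exists_bijective_components (hx : Function.Injective x) (i₀ : Fin n) :
    ∃ f : {S : Finset (Fin n) // i₀ ∈ S ∧ 2 ≤ S.card ∧ S.card ≤ n - 2} →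
      ConnectedComponents {q : Moduli x | Theta q = q}, Function.Bijective f := by
  have hfix := theta_fixed_eq hx i₀
  have hn : ∀ S : Finset (Fin n), 2 ≤ S.card → S.card ≤ n - 2 → Sᶜ.Nonempty := by
    intro S h2 h3
    rw [← Finset.card_pos, Finset.card_compl, Fintype.card_fin]
    omega
  refine exists_bijective_connectedComponents (Z := fun S => Subtype.val ⁻¹' ZSet x S.1)
    (fun S => ?_) (fun S => ?_) (fun S => ?_) (fun S T h => ?_) (fun q => ?_)
  · rw [ZSet_eq_of_fixed hx S.2.1 (hn S.1 S.2.2.1 S.2.2.2), Set.preimage_inter,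
      Subtype.coe_preimage_self, Set.univ_inter]
    refine IsOpen.preimage continuous_subtype_val ?_
    exact isOpen_biInter_finset fun i _ => isOpen_biInter_finset fun j _ =>
      isOpen_ne_fun (Moduli.continuous_traceProd i j) continuous_const
  · obtain ⟨q, hq⟩ := ZSet_nonempty hx S.2.2.1 S.2.2.2
    refine ⟨⟨q, ?_⟩, hq⟩
    rw [ZSet_eq_of_fixed hx S.2.1 (hn S.1 S.2.2.1 S.2.2.2)] at hq
    exact hq.1
  · rw [← Topology.IsInducing.subtypeVal.isPreconnected_image, Subtype.image_preimage_coe,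
      Set.inter_eq_right.2]
    · exact isPreconnected_ZSet hx S.2.2.1 S.2.2.2
    · rw [ZSet_eq_of_fixed hx S.2.1 (hn S.1 S.2.2.1 S.2.2.2)]
      exact Set.inter_subset_left
  · obtain ⟨q, hS, hT⟩ := h
    exact Subtype.ext (eq_of_mem_ZSet hx S.2.1 T.2.1 hS hT)
  · have hq := hfix.subset q.2
    simp only [Set.mem_iUnion, exists_prop] at hq
    obtain ⟨S, hS, hq⟩ := hq
    exact ⟨⟨S, hS⟩, hq⟩

/-! ### Counting the types -/

theorem card_subsets_add (hn : 3 ≤ n) (i₀ : Fin n) :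
    Nat.card {S : Finset (Fin n) // i₀ ∈ S ∧ 2 ≤ S.card ∧ S.card ≤ n - 2} + (n + 1) =
      2 ^ (n - 1) := by
  classical
  have h1 : (Finset.Icc {i₀} (Finset.univ : Finset (Fin n))).card = 2 ^ (n - 1) := by
    rw [Finset.card_Icc_finset (Finset.subset_univ _)]
    simp
  -- The excluded subsets containing `i₀` are the singleton, the full set and the `n - 1`
  -- complements of another point, `n + 1` in all.
  have h2 : Finset.Icc {i₀} (Finset.univ : Finset (Fin n)) =
      (Finset.univ.filter fun S : Finset (Fin n) => i₀ ∈ S ∧ 2 ≤ S.card ∧ S.card ≤ n - 2) ∪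
        insert {i₀} (insert Finset.univ
          ((Finset.univ.erase i₀).image fun k => Finset.univ.erase k)) := by
    ext S
    have hle : S.card ≤ n := by simpa using S.card_le_univ
    simp only [Finset.mem_Icc, Finset.singleton_subset_iff,
      Finset.subset_univ, and_true, Finset.mem_union, Finset.mem_filter, Finset.mem_univ,
      true_and, Finset.mem_insert, Finset.mem_image, Finset.mem_erase]
    constructor
    · intro hS
      have hpos := Finset.card_pos.2 ⟨_, hS⟩
      by_cases h3 : S.card = 1
      · obtain ⟨j, rfl⟩ := Finset.card_eq_one.1 h3
        rw [Finset.mem_singleton] at hS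
        subst hS
        exact Or.inr (Or.inl rfl)
      · by_cases h4 : S.card ≤ n - 2
        · exact Or.inl ⟨hS, by omega, h4⟩
        · refine Or.inr (Or.inr ?_)
          by_cases h5 : S.card = n
          · left
            rw [← Finset.card_eq_iff_eq_univ]
            simpa using h5
          · right
            have h6 : Sᶜ.card = 1 := by
              rw [Finset.card_compl, Fintype.card_fin]
              omega
            obtain ⟨j, hj⟩ := Finset.card_eq_one.1 h6
            refine ⟨j, ?_, ?_⟩
            · rintro rfl
              have h7 : j ∈ Sᶜ := by rw [hj]; simp
              exact Finset.mem_compl.1 h7 hS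
            · rw [← compl_compl S, hj, Finset.compl_singleton]
    · rintro (h | rfl | rfl | ⟨k, hk, rfl⟩)
      · exact h.1
      · simp
      · simp
      · simpa using hk.symm
  have h3 : ((Finset.univ.erase i₀).image fun k => (Finset.univ.erase k : Finset (Fin n))).card =
      n - 1 := by
    rw [Finset.card_image_of_injOn]
    · simp
    · intro k _ l _ hkl
      by_contra h
      have h4 : k ∈ Finset.univ.erase l := by simp [h]
      dsimp only at hkl
      rw [← hkl] at h4
      simp at h4
  rw [h2, Finset.card_union_of_disjoint, Finset.card_insert_of_notMem,
    Finset.card_insert_of_notMem, h3] at h1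
  · rw [Nat.card_eq_fintype_card, Fintype.card_subtype]
    omega
  · simp only [Finset.mem_image, not_exists, not_and]
    intro k _ h
    have h4 : k ∈ Finset.univ.erase k := by rw [h]; simp
    simp at h4
  · simp only [Finset.mem_insert, Finset.mem_image, not_or, not_exists, not_and]
    -- Here `n ≥ 3` matters: the singleton must differ from sets of cardinality `n` and `n - 1`.
    refine ⟨fun h => ?_, fun k _ h => ?_⟩
    · have h4 := congrArg Finset.card h
      simp at h4
      omega
    · have h4 := congrArg Finset.card h
      simp at h4
      omega
  · rw [Finset.disjoint_left]
    intro S hS hS'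
    simp only [Finset.mem_filter, Finset.mem_univ, true_and] at hS
    simp only [Finset.mem_insert, Finset.mem_image] at hS'
    rcases hS' with rfl | rfl | ⟨k, -, rfl⟩
    · simp at hS
    · simp at hS
      omega
    · simp at hS
      omega

end QPH

theorem mainTheorem3 (n : ℕ) (hn : 3 ≤ n) (x : Fin n → QPH.CP1) (hx : Function.Injective x) :
    {q : QPH.Moduli x | QPH.Theta q = q} =
        (⋃ S ∈ {S : Finset (Fin n) | (⟨0, by omega⟩ : Fin n) ∈ S ∧ 2 ≤ S.card ∧ S.card ≤ n - 2},
          QPH.ZSet x S) ∧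
      (∀ S : Finset (Fin n), (⟨0, by omega⟩ : Fin n) ∈ S → 2 ≤ S.card → S.card ≤ n - 2 →
        QPH.IsSubmanifoldOfDim (QPH.ZSet x S) (2 * (n - 3)) ∧ ¬ IsCompact (QPH.ZSet x S)) ∧
      Finite (ConnectedComponents {q : QPH.Moduli x | QPH.Theta q = q}) ∧
      Nat.card (ConnectedComponents {q : QPH.Moduli x | QPH.Theta q = q}) + (n + 1) =
        2 ^ (n - 1) := by
  obtain ⟨f, hf⟩ := QPH.exists_bijective_components hx (⟨0, by omega⟩ : Fin n)
  -- Finiteness is proved separately because `Nat.card` is 0 on infinite types, and the count for `n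
  -- = 3` is 0.
  refine ⟨QPH.theta_fixed_eq hx _, fun S _ h2 h3 => ⟨QPH.isSubmanifoldOfDim_ZSet hx h2 h3,
    QPH.not_isCompact_ZSet hx h2 h3⟩, Finite.of_surjective f hf.2, ?_⟩
  rw [← Nat.card_eq_of_bijective f hf]
  exact QPH.card_subsets_add hn _
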